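/- For a positive fundamental discriminant $d$ (including $d=1$) let $\chi_d=\left(\frac{d}{\cdot}\right)$ be the Kronecker symbol and let $L(s,\chi_d)=\sum_{n\ge1}\chi_d(n)n^{-s}$ for $\mathrm{Re}(s)>1$. Let $k,M$ be positive integers and, for $s=(s_1,\dots,s_k)\in\mathbb{C}^k$ and $w\in\mathbb{C}$, put $$A_M(s_1,\dots,s_k;w)=\sum_{d}\frac{\chi_d(M)\,L(s_1,\chi_d)\cdots L(s_k,\chi_d)}{d^{w}},$$ where $d$ runs over all positive fundamental discriminants. Let $$T_M(S)=\frac{1}{2\zeta(2)}\sum_{\substack{n_1,\dots,n_k\ge 1\\ M n_1\cdots n_k=\square}}\frac{a(Mn_1\cdots n_k)}{n_1^{s_1}\cdots n_k^{s_k}},\qquad a(n)=\prod_{p\mid n}\frac{p}{p+1},\qquad S=\{s_1,\dots,s_k\},$$ where $\square$ denotes a perfect square. (i) The series $A_M(s_1,\dots,s_k;w)$ converges absolutely if $\mathrm{Re}(w)>1$ and $\mathrm{Re}(s_j)>1$ for all $j$. (ii) $A_M$ has a meromorphic continuation, jointly in $(s_1,\dots,s_k,w)$, to the region $\mathrm{Re}(w)>1/2$,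 $\mathrm{Re}(s_j)>5/4$ for all $j$. More precisely, let $D$ be the union of this region and the region in (i). There is a function that agrees with the series in the region of (i), is holomorphic on $D$ outside the hyperplane $w=1$, and becomes holomorphic on all of $D$ after multiplication by $w-1$. (iii) If $\mathrm{Re}(s_j)>5/4$ for all $j$, then the series $T_M(S)$ converges absolutely, and the continued function satisfies $$\operatorname*{Res}_{w=1}A_M(s_1,\dots,s_k;w)=\lim_{w\to1}(w-1)A_M(s_1,\dots,s_k;w)=T_M(S).$$ The function $T_M$ is nonzero on a dense subset of $\{s\in\mathbb{C}^k:\mathrm{Re}(s_j)>5/4 \text{ for all } j\}$, so the only polar divisor of $A_M$ in the region is $w=1$, of order one. For each fixed $s$ with $T_M(S)\ne0$, the function $w\mapsto A_M(s_1,\dots,s_k;w)$ has a simple pole at $w=1$. -/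

import Mathlib

open Filter Topology

noncomputable section

/-- The Kronecker symbol `(d / n)` for a natural number `n`: it is completely multiplicative in
`n`, equals the Legendre symbol at odd primes, and `(d / 2)` is `0` for even `d`, `1` for
`d ≡ ±1 mod 8` and `-1` for `d ≡ ±3 mod 8` (which is `ZMod.χ₈ d`). -/
def kroneckerSymbol (d : ℤ) (n : ℕ) : ℤ :=
  if n = 0 then (if d.natAbs = 1 then 1 else 0)
  else ZMod.χ₈ (d : ZMod 8) ^ n.factorization 2 * jacobiSym d (n / 2 ^ n.factorization 2)

/-- `d` is a positive fundamental discriminant (`d = 1` included). -/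
def IsPosFundamentalDiscriminant (d : ℕ) : Prop :=
  (d % 4 = 1 ∧ Squarefree d) ∨ ∃ m : ℕ, d = 4 * m ∧ (m % 4 = 2 ∨ m % 4 = 3) ∧ Squarefree m

/-- The character `χ_d = (d / ·)`, with complex values. -/
def quadChar (d n : ℕ) : ℂ := (kroneckerSymbol (d : ℤ) n : ℂ)

/-- `L(s, χ_d) = ∑_{n ≥ 1} χ_d(n) n^{-s}`; it is only used in the half plane `Re s > 1` of
absolute convergence. -/
def quadL (d : ℕ) (s : ℂ) : ℂ := LSeries (quadChar d) s

/-- The term `χ_d(M) L(s_1, χ_d) ⋯ L(s_k, χ_d) d^{-w}`. -/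
def symplecticTerm {k : ℕ} (M : ℕ) (s : Fin k → ℂ) (w : ℂ) (d : ℕ) : ℂ :=
  quadChar d M * (∏ j, quadL d (s j)) / (d : ℂ) ^ w

/-- The multiple Dirichlet series `A_M(s_1, …, s_k; w)`, a sum over positive fundamental
discriminants. -/
def symplecticSeries {k : ℕ} (M : ℕ) (s : Fin k → ℂ) (w : ℂ) : ℂ :=
  ∑' d : {d : ℕ // IsPosFundamentalDiscriminant d}, symplecticTerm M s w d

/-- `a(n) = ∏_{p ∣ n} p / (p + 1)`. -/
def aFactor (n : ℕ) : ℂ := ∏ p ∈ n.primeFactors, (p : ℂ) / ((p : ℂ) + 1)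

/-- The tuples `(n_1, …, n_k)` of positive integers such that `M n_1 ⋯ n_k` is a square. -/
abbrev SquareTuple (k M : ℕ) : Type := {n : Fin k → ℕ+ // IsSquare (M * ∏ j, (n j : ℕ))}

/-- The term `a(M n_1 ⋯ n_k) n_1^{-s_1} ⋯ n_k^{-s_k}`. -/
def diagonalTerm {k : ℕ} (M : ℕ) (s : Fin k → ℂ) (n : Fin k → ℕ+) : ℂ :=
  aFactor (M * ∏ j, (n j : ℕ)) / ∏ j, ((n j : ℕ) : ℂ) ^ s j

/-- `T_M(S)` for `S = {s_1, …, s_k}`. -/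
def diagonalResidue {k : ℕ} (M : ℕ) (s : Fin k → ℂ) : ℂ :=
  1 / (2 * riemannZeta 2) * ∑' n : SquareTuple k M, diagonalTerm M s n.1

/-- The points `(s, w)` with `Re w > 1` and all `Re s_j > 1`. -/
def convergenceRegion (k : ℕ) : Set ((Fin k → ℂ) × ℂ) :=
  {p | (∀ j, 1 < (p.1 j).re) ∧ 1 < p.2.re}

/-- The points `(s, w)` with `Re w > 1/2` and all `Re s_j > 5/4`. -/
def continuationRegion (k : ℕ) : Set ((Fin k → ℂ) × ℂ) :=
  {p | (∀ j, 5 / 4 < (p.1 j).re) ∧ 1 / 2 < p.2.re}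

end

/-! ### The Pólya–Vinogradov inequality for primitive characters. -/

section PolyaVinogradov

open ZMod DirichletCharacter Complex

variable {N : ℕ} [NeZero N]

/-! Where everything converges absolutely, expand the `L(s_j, χ_d)` and sum over `d` first. A tuple
`n`, with `N = M ∏ n_j`, then contributes `∏ n_j^{-s_j}` times `∑_d χ_d(N) d^{-w}`, so the problem
is to continue this inner sum in `w` with good uniformity in `N`.

Positive fundamental discriminants are `m`, `4m` or `8m` with `m` squarefree in a class mod 4 (or
merely odd), and `χ₄` detects the class. The inner sum is therefore a combination of sums over
squarefree `m` of the two real characters `(m / N) χ₄(m)^(e+1)`, `e = 0, 1`, modulo `8N`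
(`tsum_quadChar_div_eq`). A squarefree sum of a real character `χ` is `L(w, χ) / L(2w, χ₀)` with
`χ₀` principal, so `w - 1` times the inner sum is holomorphic for `Re w > 1/2`.

Pólya–Vinogradov interpolated with the trivial bound for character sums gives `L(w, χ) ≪ q^{1/4}`
there for nontrivial `χ` mod `q` (`exists_norm_LFunction_le`). The inner sums thus cost `N^{1/4}`,
and the sum over tuples converges locally uniformly for `Re s_j > 5/4`. For `Re w > 1` the trivial
bound costs no power of `N`, which covers `Re s_j > 1`.

At `w = 1` only a trivial character survives. The one with `e = 0` is never trivial; the one with `e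
= 1` is trivial exactly when `N` is a square, and then the local factors combine to `a(N) /
(2ζ(2))`. Summing over tuples gives `T_M(S)`. Its series has positive terms at `s = (2, …, 2)`, so
by the identity theorem on complex lines it vanishes on no open set. -/

lemma dirichletCharacter_eq_gaussSum_mul_sum {χ : DirichletCharacter ℂ N} (hχ : χ.IsPrimitive)
    (m : ZMod N) :
    (N : ℂ) * χ m = gaussSum χ stdAddChar * ∑ j : ZMod N, stdAddChar (j * m) * χ⁻¹ (-j) := by
  -- Fourier inversion: the transform of a primitive `χ` is its Gauss sum times a reflected `χ⁻¹`,
  -- and transforming twice gives `N χ(-x)`, read at `x = -m`.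
  have h := congrFun (dft_dft (χ : ZMod N → ℂ)) (-m)
  rw [dft_apply] at h
  simp only [neg_neg, smul_eq_mul, mul_neg, hχ.fourierTransform_eq_inv_mul_gaussSum] at h
  rw [← h, Finset.mul_sum]
  exact Finset.sum_congr rfl fun j _ => by ring

/-- At `m = 1` the sum in the inversion formula is the complex conjugate of the Gauss sum `τ`, so `N
= |τ|²`. -/
lemma norm_gaussSum_of_isPrimitive {χ : DirichletCharacter ℂ N} (hχ : χ.IsPrimitive) :
    ‖gaussSum χ stdAddChar‖ = Real.sqrt N := by
  have h := dirichletCharacter_eq_gaussSum_mul_sum hχ 1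
  have h2 : ∑ j : ZMod N, stdAddChar (j * 1) * χ⁻¹ (-j)
      = (starRingEnd ℂ) (gaussSum χ stdAddChar) := by
    rw [gaussSum, map_sum, ← Equiv.sum_comp (Equiv.neg (ZMod N))]
    refine Finset.sum_congr rfl fun j _ => ?_
    simp only [Equiv.neg_apply, neg_neg, mul_one, map_mul]
    rw [← MulChar.star_eq_inv, MulChar.star_apply, mul_comm, AddChar.map_neg_eq_conj]
    rfl
  rw [h2, map_one, mul_one, mul_conj, normSq_eq_norm_sq] at h
  have h3 : (N : ℝ) = ‖gaussSum χ stdAddChar‖ ^ 2 := by exact_mod_cast h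
  rw [h3, Real.sqrt_sq (norm_nonneg _)]

/-- A geometric sum with ratio `z = e(t)`, `t = j / N`, is at most `2 / |z - 1| = 1 / sin(πt)`. The
minimum of `t` and `1 - t` is traded for a sum of inverses, so that summing over `j` produces
harmonic numbers. -/
lemma norm_sum_stdAddChar_le {j : ZMod N} (hj : j ≠ 0) (X : ℕ) :
    ‖∑ m ∈ Finset.range X, (stdAddChar (j * (m : ZMod N)) : ℂ)‖ ≤
      N / 2 * ((j.val : ℝ)⁻¹ + ((N - j.val : ℕ) : ℝ)⁻¹) := by
  set z : ℂ := stdAddChar j with hz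
  have hpow : ∀ m : ℕ, (stdAddChar (j * (m : ZMod N)) : ℂ) = z ^ m := fun m => by
    rw [hz, ← AddChar.map_nsmul_eq_pow, nsmul_eq_mul, mul_comm]
  simp_rw [hpow]
  have hN : (0 : ℝ) < N := Nat.cast_pos.2 (NeZero.pos N)
  have hv0 : 0 < j.val := Nat.pos_of_ne_zero fun h => hj ((ZMod.val_eq_zero j).1 h)
  have hvN : j.val < N := ZMod.val_lt j
  have hnz : ‖z‖ = 1 := by rw [hz]; exact AddChar.norm_apply _ _
  have hv0' : (0 : ℝ) < j.val := Nat.cast_pos.2 hv0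
  have hvN' : (j.val : ℝ) < N := Nat.cast_lt.2 hvN
  set t : ℝ := j.val / N with ht
  have ht0 : 0 < t := div_pos hv0' hN
  have ht1 : t < 1 := (div_lt_one hN).2 hvN'
  have hz1 : ‖z - 1‖ = 2 * Real.sin (Real.pi * t) := by
    have : z = exp (I * ((2 * Real.pi * t : ℝ) : ℂ)) := by
      rw [hz, ← ZMod.natCast_zmod_val j]
      have := ZMod.stdAddChar_coe (N := N) (j.val : ℤ)
      rw [Int.cast_natCast] at this
      rw [this, ht]
      congr 1
      push_cast
      simp
      ring
    rw [this, Complex.norm_exp_I_mul_ofReal_sub_one,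
      show 2 * Real.pi * t / 2 = Real.pi * t by ring, Real.norm_eq_abs, abs_of_nonneg]
    have := Real.sin_nonneg_of_nonneg_of_le_pi (x := Real.pi * t) (by positivity)
      (by nlinarith [Real.pi_pos])
    linarith
  -- Jordan's inequality, applied to `t` or to `1 - t`, whichever is at most `1/2`.
  have hmin : 2 * min t (1 - t) ≤ Real.sin (Real.pi * t) := by
    rcases le_total t (1 / 2) with h | h
    · have := Real.mul_le_sin (x := Real.pi * t) (by positivity) (by nlinarith [Real.pi_pos])
      have h2 : 2 / Real.pi * (Real.pi * t) = 2 * t := by field_simp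
      linarith [min_le_left t (1 - t)]
    · have := Real.mul_le_sin (x := Real.pi * (1 - t))
        (mul_nonneg Real.pi_pos.le (by linarith)) (by nlinarith [Real.pi_pos])
      have h2 : 2 / Real.pi * (Real.pi * (1 - t)) = 2 * (1 - t) := by field_simp
      have h3 : Real.sin (Real.pi * (1 - t)) = Real.sin (Real.pi * t) := by
        rw [← Real.sin_pi_sub]; congr 1; ring
      linarith [min_le_right t (1 - t)]
  have hmp : 0 < min t (1 - t) := lt_min ht0 (by linarith)
  have hz1' : z ≠ 1 := fun h => by
    rw [h, sub_self, norm_zero] at hz1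
    linarith
  rw [geom_sum_eq hz1', norm_div, hz1]
  calc ‖z ^ X - 1‖ / (2 * Real.sin (Real.pi * t)) ≤ 2 / (2 * (2 * min t (1 - t))) := by
        have : ‖z ^ X - 1‖ ≤ 2 := (norm_sub_le _ _).trans (by
          rw [norm_pow, hnz, one_pow, norm_one]; norm_num)
        gcongr
    _ ≤ 1 / 2 * (t⁻¹ + (1 - t)⁻¹) := by
        have h1 : 0 < t⁻¹ := inv_pos.2 ht0
        have h2 : 0 < (1 - t)⁻¹ := inv_pos.2 (by linarith)
        have h3 : (min t (1 - t))⁻¹ ≤ t⁻¹ + (1 - t)⁻¹ := by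
          rcases min_choice t (1 - t) with h | h <;> rw [h] <;> linarith
        calc 2 / (2 * (2 * min t (1 - t))) = 1 / 2 * (min t (1 - t))⁻¹ := by field_simp
          _ ≤ _ := by linarith
    _ = _ := by
        have : N - (j.val : ℝ) ≠ 0 := by linarith
        have e : (1 - t) = (N - j.val) / N := by rw [ht]; field_simp
        rw [e, ht, Nat.cast_sub hvN.le, inv_div, inv_div]
        ring

lemma sum_zmod_val {M : Type*} [AddCommMonoid M] (g : ℕ → M) :
    ∑ j : ZMod N, g j.val = ∑ a ∈ Finset.range N, g a := by
  obtain ⟨n, rfl⟩ := Nat.exists_eq_succ_of_ne_zero (NeZero.ne N)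
  exact Fin.sum_univ_eq_sum_range g (n + 1)

theorem polya_vinogradov_of_isPrimitive {χ : DirichletCharacter ℂ N} (hχ : χ.IsPrimitive)
    (hN : N ≠ 1) (X : ℕ) :
    ‖∑ m ∈ Finset.range X, χ (m : ZMod N)‖ ≤ Real.sqrt N * (1 + Real.log N) := by
  have hN0 : (0 : ℝ) < N := Nat.cast_pos.2 (NeZero.pos N)
  have key : (N : ℂ) * ∑ m ∈ Finset.range X, χ (m : ZMod N) = gaussSum χ stdAddChar *
      ∑ j : ZMod N, (∑ m ∈ Finset.range X, (stdAddChar (j * (m : ZMod N)) : ℂ)) * χ⁻¹ (-j) := by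
    simp_rw [Finset.mul_sum, dirichletCharacter_eq_gaussSum_mul_sum hχ, Finset.sum_mul,
      Finset.mul_sum]
    exact Finset.sum_comm
  have hbound : ‖∑ j : ZMod N, (∑ m ∈ Finset.range X, (stdAddChar (j * (m : ZMod N)) : ℂ)) *
      χ⁻¹ (-j)‖ ≤ N * (1 + Real.log N) := by
    refine (norm_sum_le _ _).trans ?_
    have h1 : ∀ j : ZMod N, ‖(∑ m ∈ Finset.range X, (stdAddChar (j * (m : ZMod N)) : ℂ)) *
        χ⁻¹ (-j)‖ ≤ (fun a : ℕ => if a = 0 then (0 : ℝ) else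
          N / 2 * ((a : ℝ)⁻¹ + ((N - a : ℕ) : ℝ)⁻¹)) j.val := by
      intro j
      -- The frequency `j = 0`, where the geometric bound fails, drops out because `χ⁻¹ 0 = 0` for
      -- `N ≠ 1`.
      by_cases hj : j = 0
      · subst hj
        have := DirichletCharacter.map_zero' χ⁻¹ hN
        simp [this]
      · have hj' : j.val ≠ 0 := fun h => hj ((ZMod.val_eq_zero j).1 h)
        simp only [hj', if_false]
        rw [norm_mul]
        refine (mul_le_of_le_one_right (norm_nonneg _) ?_).trans (norm_sum_stdAddChar_le hj X)
        exact DirichletCharacter.norm_le_one _ _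
    refine (Finset.sum_le_sum fun j _ => h1 j).trans ?_
    rw [sum_zmod_val (fun a : ℕ => if a = 0 then (0 : ℝ) else
      N / 2 * ((a : ℝ)⁻¹ + ((N - a : ℕ) : ℝ)⁻¹))]
    obtain ⟨n, hn⟩ := Nat.exists_eq_succ_of_ne_zero (NeZero.ne N)
    have hn0 : n ≠ 0 := fun h => hN (by omega)
    rw [hn, Finset.sum_range_succ', ← hn]
    simp only [Nat.add_eq_zero_iff, one_ne_zero, and_false, if_false, if_true, add_zero]
    rw [← Finset.mul_sum, Finset.sum_add_distrib]
    have hH : ∑ i ∈ Finset.range n, ((i + 1 : ℕ) : ℝ)⁻¹ = (harmonic n : ℝ) := by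
      simp [harmonic]
    have hH2 : ∑ i ∈ Finset.range n, ((N - (i + 1) : ℕ) : ℝ)⁻¹ = (harmonic n : ℝ) := by
      rw [← hH, ← Finset.sum_range_reflect]
      refine Finset.sum_congr rfl fun i hi => ?_
      rw [Finset.mem_range] at hi
      congr 2
      omega
    rw [hH, hH2]
    have := harmonic_le_one_add_log n
    have h3 : Real.log n ≤ Real.log N := Real.log_le_log (by positivity) (by rw [hn]; simp)
    calc (N : ℝ) / 2 * ((harmonic n : ℝ) + harmonic n) = N * harmonic n := by ring
      _ ≤ N * (1 + Real.log N) := by gcongr; linarith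
  have h4 := congrArg norm key
  rw [norm_mul, norm_mul, Complex.norm_natCast, norm_gaussSum_of_isPrimitive hχ] at h4
  have h5 : (N : ℝ) * ‖∑ m ∈ Finset.range X, χ (m : ZMod N)‖ ≤
      N * (Real.sqrt N * (1 + Real.log N)) := by
    rw [h4]
    calc _ ≤ Real.sqrt N * (N * (1 + Real.log N)) := by gcongr
      _ = _ := by ring
  exact le_of_mul_le_mul_left h5 hN0

end PolyaVinogradov

/-! ### Bounds for Dirichlet `L`-functions right of the critical line. -/

section LFunctionBound

open DirichletCharacter Complex MeasureTheory Asymptotics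

/-- Partial summation gives `L(s, χ) = s ∫₁^∞ S(t) t^{-s-1} dt`, and `|S(t)| ≤ min(B, t) ≤ B^{1-r}
t^r`. The integral is handled as a Mellin transform, whose holomorphy extends the formula from `Re s
> 1` to `Re s > 0` by the identity theorem. -/
lemma norm_LFunction_le_of_sum_bound {N : ℕ} [NeZero N] {χ : DirichletCharacter ℂ N} (hχ : χ ≠ 1)
    {B : ℝ} (hB : ∀ n : ℕ, ‖∑ k ∈ Finset.Icc 1 n, χ (k : ZMod N)‖ ≤ B)
    {r : ℝ} (hr0 : 0 ≤ r) (hr1 : r ≤ 1) {s : ℂ} (hs : r < s.re) :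
    ‖LFunction χ s‖ ≤ ‖s‖ * (B ^ (1 - r) / (s.re - r)) := by
  set S : ℝ → ℂ := fun t => ∑ k ∈ Finset.Icc 1 ⌊t⌋₊, χ (k : ZMod N) with hS
  have hB0 : 0 ≤ B := (norm_nonneg _).trans (hB 0)
  have hSB : ∀ t, ‖S t‖ ≤ B := fun t => hB _
  have hSt : ∀ t : ℝ, 0 ≤ t → ‖S t‖ ≤ t := fun t ht => by
    refine (norm_sum_le _ _).trans ?_
    have h1 : ∑ k ∈ Finset.Icc 1 ⌊t⌋₊, ‖χ (k : ZMod N)‖ ≤ ∑ k ∈ Finset.Icc 1 ⌊t⌋₊, (1 : ℝ) :=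
      Finset.sum_le_sum fun k _ => DirichletCharacter.norm_le_one χ (k : ZMod N)
    exact h1.trans (by simpa using Nat.floor_le ht)
  have hSr : ∀ t : ℝ, 0 ≤ t → ‖S t‖ ≤ B ^ (1 - r) * t ^ r := fun t ht => by
    calc ‖S t‖ = ‖S t‖ ^ ((1 - r) + r) := by simp
      _ = ‖S t‖ ^ (1 - r) * ‖S t‖ ^ r := by
          rw [Real.rpow_add_of_nonneg (norm_nonneg _) (by linarith) hr0]
      _ ≤ _ := by
          have h1 := hSB t
          have h2 := hSt t ht
          gcongr
  have hS0 : ∀ t : ℝ, t < 1 → S t = 0 := fun t ht => by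
    simp [hS, Nat.floor_eq_zero.2 ht]
  have hmeas : Measurable S :=
    (measurable_from_nat (f := fun n => ∑ k ∈ Finset.Icc 1 n, χ (k : ZMod N))).comp
      Nat.measurable_floor
  have hloc : LocallyIntegrableOn S (Set.Ioi 0) := by
    refine LocallyIntegrable.locallyIntegrableOn ?_ _
    refine (locallyIntegrable_const B).mono hmeas.aestronglyMeasurable (ae_of_all _ fun t => ?_)
    rw [Real.norm_of_nonneg hB0]
    exact hSB t
  have hzero : S =ᶠ[𝓝[>] 0] fun _ => 0 := by
    have : Set.Iio (1 : ℝ) ∈ 𝓝[>] (0 : ℝ) := mem_nhdsWithin_of_mem_nhds (Iio_mem_nhds one_pos)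
    filter_upwards [this] with t ht using hS0 t ht
  have hdiff : ∀ z : ℂ, 0 < z.re → DifferentiableAt ℂ (fun z => z * mellin S (-z)) z := by
    intro z hz
    refine differentiableAt_id.mul ?_
    have : DifferentiableAt ℂ (mellin S) (-z) := by
      refine mellin_differentiableAt_of_isBigO_rpow (a := 0) (b := (-z).re - 1) hloc ?_ ?_ ?_ ?_
      · refine IsBigO.of_bound B (Eventually.of_forall fun t => ?_)
        simpa using hSB t
      · simpa using hz
      · exact hzero.trans_isBigO (isBigO_zero _ _)
      · linarith
    exact this.comp z differentiableAt_id.neg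
  have hmel : ∀ z : ℂ, mellin S (-z) = ∫ t in Set.Ioi (1 : ℝ), S t * (t : ℂ) ^ (-(z + 1)) := by
    intro z
    rw [mellin]
    have h1 : ∀ t ∈ Set.Ioi (0 : ℝ) \ Set.Ici 1, (t : ℂ) ^ (-z - 1) • S t = 0 := by
      rintro t ⟨-, ht⟩
      rw [hS0 t (not_le.1 ht), smul_zero]
    rw [setIntegral_eq_of_subset_of_forall_sdiff_eq_zero measurableSet_Ioi
      (Set.Ici_subset_Ioi.2 zero_lt_one) h1, integral_Ici_eq_integral_Ioi]
    refine integral_congr_ae (ae_of_all _ fun t => ?_)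
    simp only [smul_eq_mul]
    rw [mul_comm, neg_add']
  have hO : (fun n : ℕ => ∑ k ∈ Finset.Icc 1 n, χ (k : ZMod N)) =O[atTop]
      fun n : ℕ => (n : ℝ) ^ (0 : ℝ) := by
    refine IsBigO.of_bound B (Eventually.of_forall fun n => ?_)
    simpa using hB n
  have hEq : Set.EqOn (LFunction χ) (fun z => z * mellin S (-z)) {z : ℂ | 0 < z.re} := by
    have hopen : IsOpen {z : ℂ | 0 < z.re} := isOpen_lt continuous_const continuous_re
    refine AnalyticOnNhd.eqOn_of_preconnected_of_eventuallyEq (𝕜 := ℂ) (z₀ := 2) ?_ ?_ ?_ (by simp) ?_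
    · exact ((differentiable_LFunction hχ).differentiableOn).analyticOnNhd hopen
    · exact DifferentiableOn.analyticOnNhd
        (fun z hz => (hdiff z hz).differentiableWithinAt) hopen
    · exact (convex_halfSpace_re_gt 0).isPreconnected
    · have : {z : ℂ | 1 < z.re} ∈ 𝓝 (2 : ℂ) :=
        (isOpen_lt continuous_const continuous_re).mem_nhds (by simp)
      filter_upwards [this] with z hz
      rw [hmel, LFunction_eq_LSeries χ hz]
      exact LSeries_eq_mul_integral _ le_rfl (zero_lt_one.trans hz)
        (LSeriesSummable_of_one_lt_re χ hz) hO
  rw [hEq (lt_of_le_of_lt hr0 hs : 0 < s.re), norm_mul]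
  gcongr
  rw [hmel]
  have hint : IntegrableOn (fun t : ℝ => B ^ (1 - r) * t ^ (r - s.re - 1)) (Set.Ioi 1) :=
    (integrableOn_Ioi_rpow_of_lt (by linarith) one_pos).const_mul _
  refine (norm_integral_le_of_norm_le hint ?_).trans_eq ?_
  · refine (ae_restrict_iff' measurableSet_Ioi).2 (ae_of_all _ fun t ht => ?_)
    have ht0 : (0 : ℝ) < t := zero_lt_one.trans ht
    rw [norm_mul, norm_cpow_eq_rpow_re_of_pos ht0]
    calc ‖S t‖ * t ^ (-(s + 1)).re ≤ B ^ (1 - r) * t ^ r * t ^ (-(s + 1)).re := by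
          gcongr; exact hSr t ht0.le
      _ = _ := by
          rw [mul_assoc, ← Real.rpow_add ht0]
          congr 2
          simp
          ring
  · rw [integral_const_mul, integral_Ioi_rpow_of_lt (by linarith) one_pos]
    rw [Real.one_rpow, show r - s.re - 1 + 1 = -(s.re - r) by ring, neg_div_neg_eq, mul_one_div]

/-- Primes `p ≥ 2^{1/ε}` satisfy `2 ≤ p^ε`; the fewer than `P` smaller values cost a constant factor
at most `2^P`. -/
lemma exists_two_pow_card_primeFactors_le {ε : ℝ} (hε : 0 < ε) :
    ∃ C : ℝ, 0 < C ∧ ∀ n : ℕ, n ≠ 0 → (2 : ℝ) ^ n.primeFactors.card ≤ C * (n : ℝ) ^ ε := by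
  obtain ⟨P, hP⟩ := exists_nat_ge ((2 : ℝ) ^ ε⁻¹)
  refine ⟨2 ^ P, by positivity, fun n hn => ?_⟩
  have hP0 : (0 : ℝ) < P := lt_of_lt_of_le (by positivity) hP
  have hP2 : ∀ p : ℕ, P ≤ p → (2 : ℝ) ≤ (p : ℝ) ^ ε := fun p hp => by
    have : (2 : ℝ) ^ ε⁻¹ ≤ p := hP.trans (Nat.cast_le.2 hp)
    calc (2 : ℝ) = ((2 : ℝ) ^ ε⁻¹) ^ ε := by
          rw [← Real.rpow_mul (by norm_num), inv_mul_cancel₀ hε.ne', Real.rpow_one]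
      _ ≤ _ := by gcongr
  calc (2 : ℝ) ^ n.primeFactors.card = ∏ p ∈ n.primeFactors, (2 : ℝ) := by simp
    _ ≤ ∏ p ∈ n.primeFactors, ((if p < P then 2 else 1) * (p : ℝ) ^ ε) := by
        refine Finset.prod_le_prod (fun _ _ => by norm_num) fun p hp => ?_
        have hp1 : (1 : ℝ) ≤ p := by exact_mod_cast (Nat.prime_of_mem_primeFactors hp).one_le
        have := Real.one_le_rpow hp1 hε.le
        split_ifs with h
        · linarith
        · linarith [hP2 p (not_lt.1 h)]
    _ = (∏ p ∈ n.primeFactors, (if p < P then (2 : ℝ) else 1)) *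
          ((∏ p ∈ n.primeFactors, p : ℕ) : ℝ) ^ ε := by
        rw [Finset.prod_mul_distrib, Nat.cast_prod, Real.finsetProd_rpow _ _ fun _ _ => by positivity]
    _ ≤ 2 ^ P * (n : ℝ) ^ ε := by
        gcongr
        · rw [← Finset.prod_filter, Finset.prod_const]
          refine pow_le_pow_right₀ (by norm_num) ?_
          calc _ ≤ (Finset.range P).card := Finset.card_le_card fun p hp => by
                  simpa using (Finset.mem_filter.1 hp).2
            _ = P := Finset.card_range P
        · exact Nat.le_of_dvd (Nat.pos_of_ne_zero hn) (Nat.prod_primeFactors_dvd n)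

lemma norm_prod_one_sub_le (n : ℕ) {a : ℕ → ℂ} (ha : ∀ p, ‖a p‖ ≤ 1) {s : ℂ} (hs : 0 ≤ s.re) :
    ‖∏ p ∈ n.primeFactors, (1 - a p * (p : ℂ) ^ (-s))‖ ≤ 2 ^ n.primeFactors.card := by
  rw [norm_prod, ← Finset.prod_const]
  refine Finset.prod_le_prod (fun _ _ => norm_nonneg _) fun p hp => ?_
  have hp := Nat.prime_of_mem_primeFactors hp
  refine (norm_sub_le _ _).trans ?_
  rw [norm_one, norm_mul, norm_natCast_cpow_of_pos hp.pos]
  have h1 : (p : ℝ) ^ (-s).re ≤ 1 :=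
    Real.rpow_le_one_of_one_le_of_nonpos (by exact_mod_cast hp.one_le) (by simpa using hs)
  have h2 := mul_le_one₀ (ha p) (by positivity) h1
  linarith

/-- For the inducing primitive character of conductor `f`, take `B ≪ f^{1/2+δ}` and `r = 1/2 + δ`;
the exponent is `(1/2+δ)(1/2-δ) = 1/4 - δ²`. The Euler factors lost in passing to level `N` cost at
most `2^{ω(N)} ≪ N^{δ²}`, which restores exactly `1/4`. -/
theorem exists_norm_LFunction_le {σ : ℝ} (hσ : 1 / 2 < σ) :
    ∃ C : ℝ, 0 < C ∧ ∀ (N : ℕ) [NeZero N] (χ : DirichletCharacter ℂ N), χ ≠ 1 →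
      ∀ s : ℂ, σ ≤ s.re → ‖LFunction χ s‖ ≤ C * ‖s‖ * (N : ℝ) ^ (1 / 4 : ℝ) := by
  -- `δ < σ - 1/2` makes the integral converge with `r = 1/2 + δ`, and `δ < 1/2` keeps `r < 1`.
  obtain ⟨δ, hδ0, hδ1⟩ : ∃ δ : ℝ, 0 < δ ∧ δ < min (σ - 1 / 2) (1 / 2) :=
    exists_between (lt_min (by linarith) (by norm_num))
  have hδσ : δ < σ - 1 / 2 := hδ1.trans_le (min_le_left _ _)
  have hδh : δ < 1 / 2 := hδ1.trans_le (min_le_right _ _)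
  obtain ⟨C, hC, hCN⟩ := exists_two_pow_card_primeFactors_le (pow_pos hδ0 2)
  refine ⟨(1 + δ⁻¹) / (σ - (1 / 2 + δ)) * C, mul_pos (div_pos (by positivity) (by linarith)) hC,
    fun N _ χ hχ s hs => ?_⟩
  set f := χ.conductor
  have : NeZero f := ⟨χ.conductor_ne_zero⟩
  have hf1 : f ≠ 1 := fun h => hχ (eq_one_iff_conductor_eq_one.2 h)
  set ψ := χ.primitiveCharacter
  have hψ : ψ.IsPrimitive := χ.primitiveCharacter_isPrimitive
  have hψ1 : ψ ≠ 1 := fun h => by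
    have := hψ
    rw [h, IsPrimitive, conductor_one] at this
    exact hf1 this.symm
  have hfN : f ≤ N := Nat.le_of_dvd (NeZero.pos N) χ.conductor_dvd_level
  have hf : (1 : ℝ) ≤ f := by exact_mod_cast NeZero.one_le
  have hB : ∀ n : ℕ, ‖∑ k ∈ Finset.Icc 1 n, ψ (k : ZMod f)‖ ≤
      (1 + δ⁻¹) * (f : ℝ) ^ (1 / 2 + δ) := fun n => by
    have h0 : ∑ k ∈ Finset.Icc 1 n, ψ (k : ZMod f) =
        ∑ k ∈ Finset.range (n + 1), ψ (k : ZMod f) := by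
      rw [Finset.range_eq_Ico, Finset.sum_eq_sum_Ico_succ_bot n.succ_pos, Nat.cast_zero,
        DirichletCharacter.map_zero' ψ hf1, zero_add]
      rfl
    rw [h0]
    refine (polya_vinogradov_of_isPrimitive hψ hf1 _).trans ?_
    rw [Real.rpow_add (by linarith), ← Real.sqrt_eq_rpow, mul_left_comm]
    gcongr
    have h1 := Real.log_le_rpow_div (x := f) (by linarith) hδ0
    have h2 := Real.one_le_rpow hf hδ0.le
    rw [div_eq_inv_mul] at h1
    linarith
  have hsr : 1 / 2 + δ < s.re := by linarith
  have hbd := norm_LFunction_le_of_sum_bound hψ1 hB (by linarith) (by linarith) hsr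
  have hχψ : χ = changeLevel χ.conductor_dvd_level ψ := χ.changeLevel_primitiveCharacter.symm
  rw [hχψ, LFunction_changeLevel _ _ (.inl hψ1), norm_mul]
  have hprod := norm_prod_one_sub_le N (a := fun p => ψ p)
    (fun p => DirichletCharacter.norm_le_one ψ _) (s := s) (by linarith)
  have hN1 : (1 : ℝ) ≤ N := hf.trans (Nat.cast_le.2 hfN)
  have hpow : ((1 + δ⁻¹) * (f : ℝ) ^ (1 / 2 + δ)) ^ (1 - (1 / 2 + δ)) ≤
      (1 + δ⁻¹) * (N : ℝ) ^ (1 / 4 - δ ^ 2) := by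
    rw [Real.mul_rpow (by positivity) (by positivity), ← Real.rpow_mul (by positivity),
      show (1 / 2 + δ) * (1 - (1 / 2 + δ)) = 1 / 4 - δ ^ 2 by ring]
    have hδi : 0 < δ⁻¹ := inv_pos.2 hδ0
    gcongr ?_ * ?_
    · calc (1 + δ⁻¹) ^ (1 - (1 / 2 + δ)) ≤ (1 + δ⁻¹) ^ (1 : ℝ) :=
          Real.rpow_le_rpow_of_exponent_le (by linarith) (by linarith)
        _ = _ := Real.rpow_one _
    · gcongr
      nlinarith
  calc ‖LFunction ψ s‖ * ‖∏ p ∈ N.primeFactors, (1 - ψ p * (p : ℂ) ^ (-s))‖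
      ≤ (‖s‖ * ((1 + δ⁻¹) * (N : ℝ) ^ (1 / 4 - δ ^ 2) / (σ - (1 / 2 + δ)))) *
        (C * (N : ℝ) ^ (δ ^ 2)) := by
        have h0 : 0 < σ - (1 / 2 + δ) := by linarith
        refine mul_le_mul (hbd.trans ?_) (hprod.trans (hCN N (NeZero.ne N))) (norm_nonneg _)
          (by positivity)
        gcongr
    _ = (1 + δ⁻¹) / (σ - (1 / 2 + δ)) * C * ‖s‖ *
          ((N : ℝ) ^ (1 / 4 - δ ^ 2) * (N : ℝ) ^ (δ ^ 2)) := by ring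
    _ = _ := by
        rw [← Real.rpow_add (by linarith)]
        congr 2
        ring

end LFunctionBound

/-! ### Series of holomorphic functions of several variables. -/

section SeriesOfHolomorphicFunctions

/-- Cauchy's estimate on the complex line `z ↦ x + z v`, over a disc of radius `r / (2‖v‖)` so that
the line stays inside the ball. -/
lemma norm_fderiv_le_of_norm_le_ball {E : Type*} [NormedAddCommGroup E] [NormedSpace ℂ E]
    {f : E → ℂ} {x : E} {r C : ℝ} (hr : 0 < r) (hf : DifferentiableOn ℂ f (Metric.ball x r))
    (hC : ∀ y ∈ Metric.ball x r, ‖f y‖ ≤ C) : ‖fderiv ℂ f x‖ ≤ 2 * C / r := by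
  have hC0 : 0 ≤ C := (norm_nonneg _).trans (hC x (Metric.mem_ball_self hr))
  have hfx : DifferentiableAt ℂ f x := hf.differentiableAt (Metric.ball_mem_nhds x hr)
  refine ContinuousLinearMap.opNorm_le_bound _ (by positivity) fun v => ?_
  by_cases hv : v = 0
  · simp [hv]
  have hv0 : 0 < ‖v‖ := norm_pos_iff.2 hv
  set R : ℝ := r / (2 * ‖v‖) with hR
  have hR0 : 0 < R := by positivity
  set g : ℂ → ℂ := fun z => f (x + z • v) with hg
  have hmem : ∀ z ∈ Metric.closedBall (0 : ℂ) R, x + z • v ∈ Metric.ball x r := fun z hz => by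
    rw [mem_closedBall_zero_iff] at hz
    rw [mem_ball_iff_norm, add_sub_cancel_left, norm_smul]
    calc ‖z‖ * ‖v‖ ≤ R * ‖v‖ := by gcongr
      _ = r / 2 := by rw [hR]; field_simp
      _ < r := by linarith
  have hgd : ∀ z ∈ Metric.closedBall (0 : ℂ) R, DifferentiableAt ℂ g z := fun z hz => by
    have h1 : DifferentiableAt ℂ f (x + z • v) :=
      hf.differentiableAt (Metric.isOpen_ball.mem_nhds (hmem z hz))
    exact h1.comp z (by fun_prop)
  have hderiv : deriv g 0 = fderiv ℂ f x v := by
    have h1 : HasFDerivAt f (fderiv ℂ f x) (x + (0 : ℂ) • v) := by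
      simpa using hfx.hasFDerivAt
    have h2 : HasDerivAt (fun z : ℂ => x + z • v) v 0 := by
      simpa using ((hasDerivAt_id (0 : ℂ)).smul_const v).const_add x
    exact (h1.comp_hasDerivAt (0 : ℂ) h2).deriv
  have hcl : DiffContOnCl ℂ g (Metric.ball 0 R) := by
    refine DifferentiableOn.diffContOnCl fun z hz => ?_
    rw [closure_ball _ hR0.ne'] at hz
    exact (hgd z hz).differentiableWithinAt
  have := Complex.norm_deriv_le_of_forall_mem_sphere_norm_le hR0 hcl
    (C := C) fun z hz => hC _ (hmem z (Metric.sphere_subset_closedBall hz))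
  rw [hderiv] at this
  refine this.trans_eq ?_
  rw [hR]
  field_simp

/-- The Weierstrass M-test: Cauchy's estimate on half-radius balls makes the derivatives summable
too, so termwise differentiation is legitimate. -/
theorem differentiableAt_tsum_of_summable_norm {E ι : Type*} [NormedAddCommGroup E]
    [NormedSpace ℂ E] {F : ι → E → ℂ} {U : Set E} {x : E} {u : ι → ℝ} (hU : U ∈ 𝓝 x)
    (hu : Summable u) (hF : ∀ i, DifferentiableOn ℂ (F i) U) (hFu : ∀ i, ∀ y ∈ U, ‖F i y‖ ≤ u i) :
    DifferentiableAt ℂ (fun y => ∑' i, F i y) x := by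
  obtain ⟨r, hr, hrU⟩ := Metric.mem_nhds_iff.1 hU
  have hr2 : 0 < r / 2 := by positivity
  have hsub : ∀ y ∈ Metric.ball x (r / 2), Metric.ball y (r / 2) ⊆ U := fun y hy =>
    (Metric.ball_subset_ball' (by have := Metric.mem_ball.1 hy; linarith)).trans hrU
  have hx : x ∈ Metric.ball x (r / 2) := Metric.mem_ball_self hr2
  refine (hasFDerivAt_tsum_of_isPreconnected (u := fun i => 2 * u i / (r / 2))
    (f' := fun i y => fderiv ℂ (F i) y) ((hu.mul_left 2).div_const _) Metric.isOpen_ball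
    ((Metric.isConnected_ball hr2).isPreconnected) (fun i y hy => ?_) (fun i y hy => ?_)
    hx ?_ hx).differentiableAt
  · exact ((hF i).differentiableAt (mem_of_superset (Metric.ball_mem_nhds y hr2)
      (hsub y hy))).hasFDerivAt
  · exact norm_fderiv_le_of_norm_le_ball hr2 ((hF i).mono (hsub y hy))
      fun z hz => hFu i z (hsub y hy hz)
  · exact Summable.of_norm_bounded hu fun i => hFu i x (hsub x hx hx)

theorem summable_norm_prod_and_tsum_prod {𝕜 α : Type*} [NormedField 𝕜] [CompleteSpace 𝕜] {k : ℕ}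
    {f : Fin k → α → 𝕜} (hf : ∀ j, Summable fun a => ‖f j a‖) :
    (Summable fun n : Fin k → α => ‖∏ j, f j (n j)‖) ∧
      ∑' n : Fin k → α, ∏ j, f j (n j) = ∏ j, ∑' a, f j a := by
  induction k with
  | zero => exact ⟨Summable.of_finite, by simp⟩
  | succ k ih =>
    obtain ⟨h1, h2⟩ := ih (f := fun j => f j.succ) fun j => hf j.succ
    have he : ∀ p : α × (Fin k → α), ∏ j, f j ((Fin.consEquiv fun _ => α) p j) =
        f 0 p.1 * ∏ j : Fin k, f j.succ (p.2 j) := fun p => by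
      rw [Fin.prod_univ_succ]
      simp [Fin.consEquiv]
    constructor
    · rw [← (Fin.consEquiv fun _ : Fin (k + 1) => α).summable_iff]
      refine ((hf 0).mul_norm h1).congr fun p => ?_
      simp only [Function.comp_apply]
      rw [he]
    · rw [← (Fin.consEquiv fun _ : Fin (k + 1) => α).tsum_eq, Fin.prod_univ_succ, ← h2,
        tsum_mul_tsum_of_summable_norm (hf 0) h1]
      exact tsum_congr he

lemma summable_pnat_rpow {x : ℝ} (hx : 1 < x) : Summable fun n : ℕ+ => ((n : ℕ) : ℝ) ^ (-x) :=
  (Real.summable_nat_rpow.2 (by linarith)).comp_injective PNat.coe_injective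

lemma summable_prod_pnat_rpow {k : ℕ} {x : Fin k → ℝ} (hx : ∀ j, 1 < x j) :
    Summable fun n : Fin k → ℕ+ => ∏ j, ((n j : ℕ) : ℝ) ^ (-x j) := by
  refine (summable_norm_prod_and_tsum_prod (𝕜 := ℝ)
    (f := fun j (n : ℕ+) => ((n : ℕ) : ℝ) ^ (-x j)) fun j => ?_).1.congr fun n => ?_
  · exact (summable_pnat_rpow (hx j)).norm
  · exact Real.norm_of_nonneg (Finset.prod_nonneg fun j _ => by positivity)

end SeriesOfHolomorphicFunctions

/-! ### Multiplicativity and periodicity of the Kronecker symbol. -/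

section KroneckerSymbol

lemma kroneckerSymbol_of_ne_zero (d : ℤ) {n : ℕ} (hn : n ≠ 0) :
    kroneckerSymbol d n =
      ZMod.χ₈ (d : ZMod 8) ^ n.factorization 2 * jacobiSym d (n / 2 ^ n.factorization 2) :=
  if_neg hn

lemma kroneckerSymbol_one_right (d : ℤ) : kroneckerSymbol d 1 = 1 := by
  simp [kroneckerSymbol]

lemma kroneckerSymbol_mul_right (d : ℤ) {m n : ℕ} (hm : m ≠ 0) (hn : n ≠ 0) :
    kroneckerSymbol d (m * n) = kroneckerSymbol d m * kroneckerSymbol d n := by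
  rw [kroneckerSymbol_of_ne_zero d hm, kroneckerSymbol_of_ne_zero d hn,
    kroneckerSymbol_of_ne_zero d (mul_ne_zero hm hn), Nat.ordCompl_mul,
    jacobiSym.mul_right' d (Nat.ordCompl_pos 2 hm).ne' (Nat.ordCompl_pos 2 hn).ne',
    Nat.factorization_mul hm hn, Finsupp.add_apply, pow_add]
  ring

lemma kroneckerSymbol_mul_left (d e : ℤ) {n : ℕ} (hn : n ≠ 0) :
    kroneckerSymbol (d * e) n = kroneckerSymbol d n * kroneckerSymbol e n := by
  rw [kroneckerSymbol_of_ne_zero _ hn, kroneckerSymbol_of_ne_zero _ hn,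
    kroneckerSymbol_of_ne_zero _ hn, jacobiSym.mul_left, Int.cast_mul, map_mul, mul_pow]
  ring

lemma kroneckerSymbol_one_left {n : ℕ} (hn : n ≠ 0) : kroneckerSymbol 1 n = 1 := by
  simp [kroneckerSymbol_of_ne_zero _ hn, jacobiSym.one_left]

lemma kroneckerSymbol_congr {d e : ℕ} {n : ℕ} (hn : n ≠ 0) (h : d ≡ e [MOD 8 * n]) :
    kroneckerSymbol d n = kroneckerSymbol e n := by
  rw [kroneckerSymbol_of_ne_zero _ hn, kroneckerSymbol_of_ne_zero _ hn]
  have h8 : ((d : ℤ) : ZMod 8) = ((e : ℤ) : ZMod 8) := by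
    simpa using (ZMod.natCast_eq_natCast_iff d e 8).2 (h.of_mul_right n)
  have hc : d ≡ e [MOD n / 2 ^ n.factorization 2] :=
    (h.of_mul_left 8).of_dvd (Nat.ordCompl_dvd n 2)
  rw [h8, jacobiSym.mod_left' (a₂ := (e : ℤ))]
  exact_mod_cast hc

lemma abs_kroneckerSymbol_le_one (d : ℤ) (n : ℕ) : |kroneckerSymbol d n| ≤ 1 := by
  rw [kroneckerSymbol]
  split_ifs
  · simp
  · simp
  · rw [abs_mul, abs_pow]
    have h1 : |ZMod.χ₈ (d : ZMod 8)| ≤ 1 := by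
      rcases ZMod.isQuadratic_χ₈ (d : ZMod 8) with h | h | h <;> simp [h]
    have h2 : |jacobiSym d (n / 2 ^ n.factorization 2)| ≤ 1 := by
      rcases jacobiSym.trichotomy d (n / 2 ^ n.factorization 2) with h | h | h <;> simp [h]
    exact mul_le_one₀ (pow_le_one₀ (abs_nonneg _) h1) (abs_nonneg _) h2

lemma sq_eq_one_of_abs_le_one {x : ℤ} (h : |x| ≤ 1) (h0 : x ≠ 0) : x ^ 2 = 1 := by
  have := abs_le.1 h
  obtain h | h : x = 1 ∨ x = -1 := by omega
  all_goals simp [h]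

lemma pow_three_eq_self_of_abs_le_one {x : ℤ} (h : |x| ≤ 1) : x ^ 3 = x := by
  have := abs_le.1 h
  obtain h | h | h : x = 1 ∨ x = 0 ∨ x = -1 := by omega
  all_goals simp [h]

end KroneckerSymbol

/-! ### The real characters `d ↦ (d / N) χ₄(d)^(e+1)` and when they are trivial. -/

section TwistedCharacter

/-- The Dirichlet character `d ↦ (d / N) χ₄(d)^(e+1)` modulo `8 * N`. -/
noncomputable def kroneckerChar (N : ℕ) [NeZero N] (e : ℕ) : DirichletCharacter ℂ (8 * N) :=
  MulChar.mk
    ⟨⟨fun x => ((kroneckerSymbol (x.val : ℕ) N * ZMod.χ₄ (x.val : ZMod 4) ^ (e + 1) : ℤ) : ℂ), by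
      have : Fact (1 < 8 * N) := ⟨by have := NeZero.pos N; omega⟩
      rw [ZMod.val_one]
      simp [kroneckerSymbol_one_left (NeZero.ne N)]⟩, fun x y => by
      have h : (x * y).val ≡ x.val * y.val [MOD 8 * N] := by
        rw [ZMod.val_mul]
        exact Nat.mod_modEq _ _
      have h4 : (((x * y).val : ℕ) : ZMod 4) = ((x.val * y.val : ℕ) : ZMod 4) :=
        (ZMod.natCast_eq_natCast_iff _ _ 4).2 (h.of_dvd ⟨2 * N, by ring⟩)
      simp only
      rw [kroneckerSymbol_congr (NeZero.ne N) h, h4, Nat.cast_mul, Nat.cast_mul, map_mul,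
        kroneckerSymbol_mul_left _ _ (NeZero.ne N), mul_pow]
      push_cast
      ring⟩
    -- If the `χ₄` factor is nonzero then `x` is odd, so a nonunit `x` must share a factor with the
    -- odd part of `N`, where the Jacobi symbol vanishes. The exponent `e + 1 ≥ 1` is what kills
    -- even `x`.
    fun x hx => by
      simp only
      rw [Int.cast_eq_zero, mul_eq_zero, or_iff_not_imp_right]
      intro h4
      have h4' : ZMod.χ₄ (x.val : ZMod 4) ≠ 0 := fun h => h4 (by rw [h, zero_pow e.succ_ne_zero])
      have hodd : x.val % 2 = 1 := by
        rw [ZMod.χ₄_nat_eq_if_mod_four] at h4'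
        split_ifs at h4' <;> omega
      have hc8 : Nat.Coprime x.val 8 :=
        Nat.Coprime.pow_right 3 (Nat.coprime_comm.1 ((Nat.coprime_two_left).2
          (Nat.odd_iff.2 hodd)))
      have hN : N ≠ 0 := NeZero.ne N
      rw [kroneckerSymbol_of_ne_zero _ hN]
      refine mul_eq_zero_of_right _ ?_
      have : NeZero (N / 2 ^ N.factorization 2) := ⟨(Nat.ordCompl_pos 2 hN).ne'⟩
      rw [jacobiSym.eq_zero_iff_not_coprime, Int.gcd_natCast_natCast]
      intro hc
      apply hx
      rw [← ZMod.natCast_zmod_val x, ZMod.isUnit_iff_coprime]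
      refine Nat.Coprime.mul_right hc8 ?_
      suffices h : Nat.Coprime x.val (2 ^ N.factorization 2 * (N / 2 ^ N.factorization 2)) by
        rwa [Nat.ordProj_mul_ordCompl_eq_self N 2] at h
      refine Nat.Coprime.mul_right (Nat.Coprime.pow_right _ ?_) hc
      exact Nat.coprime_comm.1 ((Nat.coprime_two_left).2 (Nat.odd_iff.2 hodd))

variable {N : ℕ} [NeZero N]

lemma kroneckerChar_apply (e : ℕ) (x : ZMod (8 * N)) :
    kroneckerChar N e x =
      ((kroneckerSymbol (x.val : ℕ) N * ZMod.χ₄ (x.val : ZMod 4) ^ (e + 1) : ℤ) : ℂ) := rfl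

lemma kroneckerChar_natCast (e d : ℕ) :
    kroneckerChar N e (d : ZMod (8 * N)) =
      ((kroneckerSymbol (d : ℕ) N * ZMod.χ₄ (d : ZMod 4) ^ (e + 1) : ℤ) : ℂ) := by
  have h : (d : ZMod (8 * N)).val ≡ d [MOD 8 * N] := by
    rw [ZMod.val_natCast]
    exact Nat.mod_modEq _ _
  have h4 : (((d : ZMod (8 * N)).val : ℕ) : ZMod 4) = (d : ZMod 4) :=
    (ZMod.natCast_eq_natCast_iff _ _ 4).2 (h.of_dvd ⟨2 * N, by ring⟩)
  rw [kroneckerChar_apply, kroneckerSymbol_congr (NeZero.ne N) h, h4]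

lemma abs_χ₄_le_one (x : ZMod 4) : |ZMod.χ₄ x| ≤ 1 := by
  rcases ZMod.isQuadratic_χ₄ x with h | h | h <;> simp [h]

lemma kroneckerChar_sq (e : ℕ) : kroneckerChar N e ^ 2 = 1 := by
  refine MulChar.ext fun u => ?_
  rw [MulChar.one_apply_coe, MulChar.pow_apply_coe]
  have hu : kroneckerChar N e (u : ZMod (8 * N)) ≠ 0 := (u.isUnit.map (kroneckerChar N e)).ne_zero
  rw [kroneckerChar_apply] at hu ⊢
  rw [Int.cast_ne_zero] at hu
  have hb : |kroneckerSymbol ((u : ZMod (8 * N)).val : ℕ) N *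
      ZMod.χ₄ ((u : ZMod (8 * N)).val : ZMod 4) ^ (e + 1)| ≤ 1 := by
    rw [abs_mul, abs_pow]
    exact mul_le_one₀ (abs_kroneckerSymbol_le_one _ _) (by positivity)
      (pow_le_one₀ (abs_nonneg _) (abs_χ₄_le_one _))
  exact_mod_cast sq_eq_one_of_abs_le_one hb hu

lemma kroneckerChar_ne_one_of_eq_neg_one {e d : ℕ}
    (h : kroneckerSymbol (d : ℕ) N * ZMod.χ₄ (d : ZMod 4) ^ (e + 1) = -1) :
    kroneckerChar N e ≠ 1 := by
  intro h1
  have h2 := kroneckerChar_natCast (N := N) e d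
  rw [h, h1] at h2
  by_cases hu : IsUnit (d : ZMod (8 * N))
  · rw [MulChar.one_apply hu] at h2
    norm_num at h2
  · rw [MulChar.map_nonunit _ hu] at h2
    norm_num at h2

/-- By the Chinese remainder theorem `d` can be `r` mod 8 and `1` modulo the odd part of `N`; the
symbol then sees only the power of 2 in `N`. -/
lemma exists_kroneckerSymbol_eq (N : ℕ) [NeZero N] (r : ℕ) (hr : r < 8) :
    ∃ d : ℕ, d % 8 = r ∧
      kroneckerSymbol (d : ℕ) N = ZMod.χ₈ (r : ZMod 8) ^ N.factorization 2 := by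
  have hN : N ≠ 0 := NeZero.ne N
  have hc : Nat.Coprime 8 (N / 2 ^ N.factorization 2) :=
    Nat.Coprime.pow_left 3 (Nat.coprime_ordCompl Nat.prime_two hN)
  obtain ⟨d, hd8, hd⟩ := Nat.chineseRemainder hc r 1
  have hd8' : d % 8 = r := by
    have : d % 8 = r % 8 := hd8
    omega
  refine ⟨d, hd8', ?_⟩
  rw [kroneckerSymbol_of_ne_zero _ hN]
  have h1 : ((d : ℤ) : ZMod 8) = (r : ZMod 8) := by
    simpa using (ZMod.natCast_eq_natCast_iff d r 8).2 hd8
  have h2 : jacobiSym (d : ℕ) (N / 2 ^ N.factorization 2) = 1 := by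
    rw [jacobiSym.mod_left' (a₂ := 1), jacobiSym.one_left]
    exact_mod_cast hd
  rw [h1, h2, mul_one]

lemma kroneckerChar_zero_ne_one : kroneckerChar N 0 ≠ 1 := by
  -- The class of `7` has `χ₈ = 1` and `χ₄ = -1`, so the `χ₄` twist alone makes the value `-1`,
  -- whatever `N` is.
  obtain ⟨d, hd, hk⟩ := exists_kroneckerSymbol_eq N 7 (by norm_num)
  refine kroneckerChar_ne_one_of_eq_neg_one (d := d) ?_
  rw [hk, ZMod.χ₄_nat_three_mod_four (by omega), show ZMod.χ₈ ((7 : ℕ) : ZMod 8) = 1 by decide]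
  simp

lemma isSquare_of_even_factorization {n : ℕ} (hn : n ≠ 0) (h : ∀ p, Even (n.factorization p)) :
    IsSquare n := by
  rw [← Nat.prod_factorization_pow_eq_self hn]
  refine Finset.isSquare_prod _ fun p _ => ?_
  exact (h p).isSquare_pow p

/-- If 2 has odd exponent in `N`, a `d ≡ 5` mod 8 gives `-1`. Otherwise the odd part is a nonsquare
and has a prime `p` of odd exponent; a nonresidue mod `p` that is `1` modulo 8 and the rest of the
odd part gives `-1`. -/
lemma kroneckerChar_one_ne_one (hsq : ¬ IsSquare N) : kroneckerChar N 1 ≠ 1 := by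
  have hN : N ≠ 0 := NeZero.ne N
  by_cases ha : Even (N.factorization 2)
  · set n := N / 2 ^ N.factorization 2 with hn
    have hn0 : n ≠ 0 := (Nat.ordCompl_pos 2 hN).ne'
    have hodd : ¬ 2 ∣ n := Nat.not_dvd_ordCompl Nat.prime_two hN
    have hnsq : ¬ IsSquare n := fun h => hsq (by
      rw [← Nat.ordProj_mul_ordCompl_eq_self N 2]
      exact (ha.isSquare_pow 2).mul h)
    obtain ⟨p, hp⟩ : ∃ p, ¬ Even (n.factorization p) := by
      by_contra! h
      exact hnsq (isSquare_of_even_factorization hn0 h)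
    have hpp : p.Prime := by
      by_contra h
      exact hp (by simp [Nat.factorization_eq_zero_of_not_prime n h])
    have : Fact p.Prime := ⟨hpp⟩
    have hpn : p ∣ n := Nat.dvd_of_factorization_pos fun h => hp (by simp [h])
    have hp2 : p ≠ 2 := fun h => hodd (h ▸ hpn)
    obtain ⟨u, hu⟩ := FiniteField.exists_nonsquare (F := ZMod p) (by rwa [ZMod.ringChar_zmod_n])
    set m := n / p ^ n.factorization p with hm
    have hm0 : m ≠ 0 := (Nat.ordCompl_pos p hn0).ne'
    have hpc : Nat.Coprime p (8 * m) :=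
      Nat.Coprime.mul_right (Nat.Coprime.pow_right 3 ((Nat.coprime_primes hpp Nat.prime_two).2 hp2))
        (Nat.coprime_ordCompl hpp hn0)
    obtain ⟨d, hdp, hd⟩ := Nat.chineseRemainder hpc u.val 1
    have hd8 : d % 8 = 1 := hd.of_mul_right m
    have hJp : jacobiSym (d : ℕ) p = -1 := by
      refine (ZMod.nonsquare_iff_jacobiSym_eq_neg_one (p := p)).2 ?_
      have : ((d : ℕ) : ZMod p) = u := by
        rw [(ZMod.natCast_eq_natCast_iff d u.val p).2 hdp, ZMod.natCast_zmod_val]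
      simpa [this] using hu
    have hJm : jacobiSym (d : ℕ) m = 1 := by
      rw [jacobiSym.mod_left' (a₂ := 1), jacobiSym.one_left]
      exact_mod_cast (hd.of_mul_left 8)
    have hJ : jacobiSym (d : ℕ) n = -1 := by
      rw [← Nat.ordProj_mul_ordCompl_eq_self n p, jacobiSym.mul_right' _
        (pow_ne_zero _ hpp.ne_zero) hm0, jacobiSym.pow_right, hJp, hJm, mul_one]
      exact (Nat.not_even_iff_odd.1 hp).neg_one_pow
    refine kroneckerChar_ne_one_of_eq_neg_one (d := d) ?_
    rw [kroneckerSymbol_of_ne_zero _ hN, ← hn, hJ, ZMod.χ₄_nat_one_mod_four (by omega),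
      Int.cast_natCast, ZMod.χ₈_nat_mod_eight, hd8]
    simp
  · obtain ⟨d, hd, hk⟩ := exists_kroneckerSymbol_eq N 5 (by norm_num)
    refine kroneckerChar_ne_one_of_eq_neg_one (d := d) ?_
    rw [hk, ZMod.χ₄_nat_one_mod_four (by omega), show ZMod.χ₈ ((5 : ℕ) : ZMod 8) = -1 by decide,
      (Nat.not_even_iff_odd.1 ha).neg_one_pow]
    simp

lemma kroneckerChar_one_eq_one (hsq : IsSquare N) : kroneckerChar N 1 = 1 := by
  refine MulChar.ext fun u => ?_
  rw [MulChar.one_apply_coe]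
  have hu : kroneckerChar N 1 (u : ZMod (8 * N)) ≠ 0 := (u.isUnit.map (kroneckerChar N 1)).ne_zero
  rw [kroneckerChar_apply] at hu ⊢
  rw [Int.cast_ne_zero] at hu
  obtain ⟨m, hm⟩ := hsq
  have hm0 : m ≠ 0 := fun h => NeZero.ne N (by rw [hm, h, mul_zero])
  set d := (u : ZMod (8 * N)).val
  have h1 : kroneckerSymbol d N = kroneckerSymbol d m ^ 2 := by
    rw [hm, kroneckerSymbol_mul_right _ hm0 hm0, sq]
  have h2 : kroneckerSymbol d m ≠ 0 := fun h => hu (by rw [h1, h]; simp)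
  have h3 : ZMod.χ₄ (d : ZMod 4) ≠ 0 := fun h => hu (by rw [h]; simp)
  rw [h1, sq_eq_one_of_abs_le_one (abs_kroneckerSymbol_le_one _ _) h2,
    sq_eq_one_of_abs_le_one (abs_χ₄_le_one _) h3]
  simp

end TwistedCharacter

/-! ### Dirichlet series over squarefree integers. -/

section SquarefreeSum

open scoped Classical in
/-- `f` restricted to squarefree integers. -/
noncomputable def squarefreePart (f : ℕ → ℂ) (n : ℕ) : ℂ := if Squarefree n then f n else 0

lemma norm_squarefreePart_le (f : ℕ → ℂ) (n : ℕ) : ‖squarefreePart f n‖ ≤ ‖f n‖ := by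
  rw [squarefreePart]
  split_ifs <;> simp

lemma sq_mul_squarefree_injective {a b a' b' : ℕ} (hb : b ≠ 0) (hb' : b' ≠ 0)
    (ha : Squarefree a) (ha' : Squarefree a') (h : b ^ 2 * a = b' ^ 2 * a') :
    b = b' ∧ a = a' := by
  have key : ∀ p, b.factorization p = b'.factorization p ∧
      a.factorization p = a'.factorization p := fun p => by
    have h1 := congrArg (fun n => n.factorization p) h
    simp only [Nat.factorization_mul (pow_ne_zero 2 hb) ha.ne_zero,
      Nat.factorization_mul (pow_ne_zero 2 hb') ha'.ne_zero, Nat.factorization_pow,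
      Finsupp.add_apply, Finsupp.smul_apply, smul_eq_mul] at h1
    have h2 := ha.natFactorization_le_one p
    have h3 := ha'.natFactorization_le_one p
    omega
  exact ⟨Nat.eq_of_factorization_eq hb hb' fun p => (key p).1,
    Nat.eq_of_factorization_eq ha.ne_zero ha'.ne_zero fun p => (key p).2⟩

variable {q : ℕ} (χ : DirichletCharacter ℂ q)

lemma LSeriesSummable_squarefreePart {s : ℂ} (hs : 1 < s.re) :
    LSeriesSummable (squarefreePart (χ ·)) s := by
  refine LSeriesSummable_of_bounded_of_one_lt_re (m := 1) (fun n _ => ?_) hs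
  exact (norm_squarefreePart_le _ n).trans (DirichletCharacter.norm_le_one χ _)

/-- Every `n ≥ 1` is uniquely `b² a` with `a` squarefree, and `χ(b² a) = χ²(b) χ(a)`. -/
lemma LSeries_sq_mul_LSeries_squarefreePart {s : ℂ} (hs : 1 < s.re) :
    LSeries (fun n : ℕ => (χ ^ 2) n) (2 * s) * LSeries (squarefreePart (χ ·)) s =
      LSeries (χ ·) s := by
  have hs2 : 1 < (2 * s).re := by simp; linarith
  have h1 := (DirichletCharacter.LSeriesSummable_of_one_lt_re (χ ^ 2) hs2).norm
  have h2 := (LSeriesSummable_squarefreePart χ hs).norm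
  rw [LSeries, LSeries, tsum_mul_tsum_of_summable_norm h1 h2, LSeries]
  let T : Set (ℕ × ℕ) := {p | p.1 ≠ 0 ∧ Squarefree p.2}
  let i : T → ℕ := fun p => p.1.1 ^ 2 * p.1.2
  have hi : Function.Injective i := fun p p' h => by
    obtain ⟨h1, h2⟩ := sq_mul_squarefree_injective p.2.1 p'.2.1 p.2.2 p'.2.2 h
    exact Subtype.ext (Prod.ext h1 h2)
  rw [← hi.tsum_eq, ← tsum_subtype_eq_of_support_subset (s := T)]
  · refine tsum_congr fun ⟨⟨b, a⟩, hb, ha⟩ => ?_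
    simp only at hb ha
    have hi0 : b ^ 2 * a ≠ 0 := mul_ne_zero (pow_ne_zero 2 hb) ha.ne_zero
    simp only [i]
    rw [LSeries.term_of_ne_zero hb, LSeries.term_of_ne_zero ha.ne_zero,
      LSeries.term_of_ne_zero hi0, squarefreePart, if_pos ha, MulChar.pow_apply' _ two_ne_zero]
    push_cast
    rw [map_mul, map_pow, div_mul_div_comm, ← Nat.cast_pow, ← Nat.cast_mul,
      Nat.cast_mul (b ^ 2) a, Complex.natCast_mul_natCast_cpow, Nat.cast_pow,
      ← Complex.natCast_cpow_natCast_mul]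
    norm_cast
  · intro p hp
    rw [Function.mem_support] at hp
    refine ⟨fun h => hp (by simp [h]), ?_⟩
    by_contra h
    refine hp (mul_eq_zero_of_right _ ?_)
    rw [LSeries.term_def, squarefreePart, if_neg h]
    simp
  · intro n hn
    have hn0 : n ≠ 0 := fun h => hn (by simp [h])
    obtain ⟨a, b, hab, ha⟩ := Nat.sq_mul_squarefree n
    refine ⟨⟨(b, a), ⟨fun (h : b = 0) => hn0 (by rw [← hab, h]; simp), ha⟩⟩, hab⟩

/-- `∑ μ(l) l^{-2s}` over `l` prime to the level. -/
noncomputable def moebiusFactor (q : ℕ) (s : ℂ) : ℂ :=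
  LSeries (fun n : ℕ => (1 : DirichletCharacter ℂ q) n * (ArithmeticFunction.moebius n : ℂ)) (2 * s)

lemma LSeries_one_mul_moebiusFactor (q : ℕ) {s : ℂ} (hs : 1 / 2 < s.re) :
    LSeries (fun n : ℕ => (1 : DirichletCharacter ℂ q) n) (2 * s) * moebiusFactor q s = 1 :=
  DirichletCharacter.LSeries.mul_mu_eq_one 1 (by simp; linarith)

variable {χ}

lemma LSeries_squarefreePart_eq (hχ : χ ^ 2 = 1) {s : ℂ} (hs : 1 < s.re) :
    LSeries (squarefreePart (χ ·)) s = LSeries (χ ·) s * moebiusFactor q s := by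
  rw [← LSeries_sq_mul_LSeries_squarefreePart χ hs, hχ, mul_right_comm,
    LSeries_one_mul_moebiusFactor q (by linarith), one_mul]

lemma norm_one_mul_moebius_le (q n : ℕ) :
    ‖(1 : DirichletCharacter ℂ q) n * (ArithmeticFunction.moebius n : ℂ)‖ ≤ 1 := by
  rw [norm_mul]
  refine mul_le_one₀ (DirichletCharacter.norm_le_one _ _) (norm_nonneg _) ?_
  rw [Complex.norm_intCast]
  exact_mod_cast ArithmeticFunction.abs_moebius_le_one

lemma differentiableAt_moebiusFactor (q : ℕ) {s : ℂ} (hs : 1 / 2 < s.re) :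
    DifferentiableAt ℂ (moebiusFactor q) s := by
  have h : LSeries.abscissaOfAbsConv (fun n : ℕ => (1 : DirichletCharacter ℂ q) n *
      (ArithmeticFunction.moebius n : ℂ)) < (2 * s).re := by
    refine lt_of_le_of_lt (LSeries.abscissaOfAbsConv_le_of_le_const
      ⟨1, fun n _ => norm_one_mul_moebius_le q n⟩) ?_
    have : (1 : ℝ) < (2 * s).re := by simp; linarith
    exact_mod_cast this
  exact (LSeries_hasDerivAt h).differentiableAt.comp s (by fun_prop)

lemma norm_LSeries_le_of_norm_le_one {f : ℕ → ℂ} (hf : ∀ n, ‖f n‖ ≤ 1) {σ : ℝ} (hσ : 1 < σ) {s : ℂ}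
    (hs : σ ≤ s.re) : ‖LSeries f s‖ ≤ ∑' n : ℕ, (n : ℝ) ^ (-σ) := by
  have hsum : Summable fun n : ℕ => (n : ℝ) ^ (-σ) := Real.summable_nat_rpow.2 (by linarith)
  refine tsum_of_norm_bounded hsum.hasSum fun n => ?_
  rcases Nat.eq_zero_or_pos n with rfl | hn
  · simp only [LSeries.term_zero, norm_zero]
    positivity
  · rw [LSeries.term_of_ne_zero hn.ne', norm_div, Complex.norm_natCast_cpow_of_pos hn,
      Real.rpow_neg (Nat.cast_nonneg n), ← one_div]
    have h1 : (1 : ℝ) ≤ n := by exact_mod_cast hn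
    gcongr
    exact hf n

end SquarefreeSum

/-! ### Reduction of sums over discriminants to squarefree sums. -/

section DiscriminantSum

lemma isPosFundamentalDiscriminant_setOf_eq :
    {d : ℕ | IsPosFundamentalDiscriminant d} = {d : ℕ | d % 4 = 1 ∧ Squarefree d} ∪
      ((fun m => 4 * m) '' {m : ℕ | m % 4 = 3 ∧ Squarefree m} ∪
        (fun m => 8 * m) '' {m : ℕ | m % 2 = 1 ∧ Squarefree m}) := by
  have h2 : ∀ m : ℕ, m % 2 = 1 → (Squarefree (2 * m) ↔ Squarefree m) := fun m hm => by
    rw [Nat.squarefree_mul ((Nat.coprime_two_left).2 (Nat.odd_iff.2 hm))]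
    simp [Nat.prime_two.squarefree]
  ext d
  simp only [Set.mem_ofPred_eq, Set.mem_union, Set.mem_image, IsPosFundamentalDiscriminant]
  refine or_congr Iff.rfl ⟨?_, ?_⟩
  · rintro ⟨m, rfl, h | h, hm⟩
    · obtain ⟨c, rfl⟩ : 2 ∣ m := by omega
      exact Or.inr ⟨c, ⟨by omega, (h2 c (by omega)).1 hm⟩, by ring⟩
    · exact Or.inl ⟨m, ⟨h, hm⟩, rfl⟩
  · rintro (⟨m, ⟨h, hm⟩, rfl⟩ | ⟨m, ⟨h, hm⟩, rfl⟩)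
    · exact ⟨m, rfl, Or.inr h, hm⟩
    · exact ⟨2 * m, by ring, Or.inl (by omega), (h2 m h).2 hm⟩

lemma tsum_isPosFundamentalDiscriminant {g : ℕ → ℂ} (hg : Summable g) :
    ∑' d : {d : ℕ // IsPosFundamentalDiscriminant d}, g d =
      ∑' d : {d : ℕ | d % 4 = 1 ∧ Squarefree d}, g d +
      (∑' m : {m : ℕ | m % 4 = 3 ∧ Squarefree m}, g (4 * m) +
        ∑' m : {m : ℕ | m % 2 = 1 ∧ Squarefree m}, g (8 * m)) := by
  have hs : ∀ S : Set ℕ, Summable (g ∘ ((↑) : S → ℕ)) := fun S => hg.subtype S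
  have h0 : ∑' d : {d : ℕ // IsPosFundamentalDiscriminant d}, g d =
      ∑' d : {d : ℕ | IsPosFundamentalDiscriminant d}, g d := rfl
  rw [h0, isPosFundamentalDiscriminant_setOf_eq, Summable.tsum_union_disjoint _ (hs _) (hs _),
    Summable.tsum_union_disjoint _ (hs _) (hs _),
    tsum_image g (fun a _ b _ h => Nat.eq_of_mul_eq_mul_left (by norm_num) h),
    tsum_image g (fun a _ b _ h => Nat.eq_of_mul_eq_mul_left (by norm_num) h)]
  · rw [Set.disjoint_left]
    rintro _ ⟨a, ⟨ha, -⟩, rfl⟩ ⟨b, ⟨hb, -⟩, h⟩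
    simp only at h
    omega
  · rw [Set.disjoint_left]
    rintro d ⟨hd, -⟩ (⟨a, ⟨ha, -⟩, rfl⟩ | ⟨b, ⟨hb, -⟩, rfl⟩) <;> simp only at hd <;> omega

lemma norm_quadChar_le_one (d n : ℕ) : ‖quadChar d n‖ ≤ 1 := by
  rw [quadChar, Complex.norm_intCast]
  exact_mod_cast abs_kroneckerSymbol_le_one d n

lemma norm_quadChar_div_le (d n : ℕ) (w : ℂ) (hw : w ≠ 0) :
    ‖quadChar d n / (d : ℂ) ^ w‖ ≤ (d : ℝ) ^ (-w.re) := by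
  rcases Nat.eq_zero_or_pos d with rfl | hd
  · rw [Nat.cast_zero, Complex.zero_cpow hw]
    simpa using Real.rpow_nonneg le_rfl _
  · rw [norm_div, Complex.norm_natCast_cpow_of_pos hd, Real.rpow_neg (Nat.cast_nonneg d), ← one_div]
    gcongr
    exact norm_quadChar_le_one d n

lemma summable_quadChar_div (n : ℕ) {w : ℂ} (hw : 1 < w.re) :
    Summable fun d : ℕ => quadChar d n / (d : ℂ) ^ w := by
  refine Summable.of_norm_bounded (Real.summable_nat_rpow.2 (show -w.re < -1 by linarith)) fun d => ?_
  exact norm_quadChar_div_le d n w fun h => by simp [h] at hw; linarith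

variable {N : ℕ} [NeZero N]

lemma term_squarefreePart_kroneckerChar (e : ℕ) (w : ℂ) {d : ℕ} (hd : Squarefree d) :
    LSeries.term (squarefreePart (kroneckerChar N e ·)) w d =
      quadChar d N * (ZMod.χ₄ (d : ZMod 4) : ℂ) ^ (e + 1) / (d : ℂ) ^ w := by
  rw [LSeries.term_of_ne_zero hd.ne_zero, squarefreePart, if_pos hd, kroneckerChar_natCast, quadChar]
  push_cast
  rfl

lemma term_squarefreePart_of_not (f : ℕ → ℂ) (w : ℂ) {d : ℕ} (hd : ¬ Squarefree d) :
    LSeries.term (squarefreePart f) w d = 0 := by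
  rw [LSeries.term_def, squarefreePart, if_neg hd]
  simp

/-- The coefficient of the character `d ↦ (d / N) χ₄(d)²` in the sum over discriminants. -/
noncomputable def evenCoeff (N : ℕ) (w : ℂ) : ℂ :=
  1 / 2 + (kroneckerSymbol 2 N : ℂ) ^ 2 / 2 * (4 : ℂ) ^ (-w) + kroneckerSymbol 2 N * (8 : ℂ) ^ (-w)

/-- The coefficient of the character `d ↦ (d / N) χ₄(d)` in the sum over discriminants. -/
noncomputable def oddCoeff (N : ℕ) (w : ℂ) : ℂ :=
  1 / 2 - (kroneckerSymbol 2 N : ℂ) ^ 2 / 2 * (4 : ℂ) ^ (-w)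

/-- On integers, `(χ₄² + χ₄)/2`, `(χ₄² - χ₄)/2` and `χ₄²` are the indicators of `1` mod 4, `3` mod 4
and odd. With `ε = (2 / N)` the discriminants `4m` and `8m` carry factors `ε²` and `ε³ = ε`. -/
theorem tsum_quadChar_div_eq {w : ℂ} (hw : 1 < w.re) :
    ∑' d : {d : ℕ // IsPosFundamentalDiscriminant d}, quadChar d N / ((d : ℕ) : ℂ) ^ w =
      LSeries (squarefreePart (kroneckerChar N 1 ·)) w * evenCoeff N w +
        LSeries (squarefreePart (kroneckerChar N 0 ·)) w * oddCoeff N w := by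
  have hN : N ≠ 0 := NeZero.ne N
  set t1 := LSeries.term (squarefreePart (kroneckerChar N 1 ·)) w with ht1
  set t0 := LSeries.term (squarefreePart (kroneckerChar N 0 ·)) w with ht0
  have hs1 : Summable t1 := LSeriesSummable_squarefreePart _ hw
  have hs0 : Summable t0 := LSeriesSummable_squarefreePart _ hw
  set ε : ℂ := (kroneckerSymbol 2 N : ℂ) with hε
  have hε3 : ε ^ 3 = ε := by
    rw [hε]
    exact_mod_cast pow_three_eq_self_of_abs_le_one (abs_kroneckerSymbol_le_one 2 N)
  have hmul : ∀ (j m : ℕ), quadChar (2 ^ j * m) N = ε ^ j * quadChar m N := fun j m => by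
    have h : kroneckerSymbol ((2 : ℤ) ^ j) N = kroneckerSymbol 2 N ^ j := by
      induction j with
      | zero => simp [kroneckerSymbol_one_left hN]
      | succ j ih => rw [pow_succ, kroneckerSymbol_mul_left _ _ hN, ih, pow_succ]
    rw [quadChar, quadChar, hε]
    push_cast
    rw [kroneckerSymbol_mul_left _ _ hN, h]
    push_cast
    rfl
  have hcp : ∀ (c m : ℕ), ((c * m : ℕ) : ℂ) ^ w = (c : ℂ) ^ w * (m : ℂ) ^ w := fun c m => by
    rw [Nat.cast_mul, Complex.natCast_mul_natCast_cpow]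
  have e1 : ∀ d : ℕ, Set.indicator {d : ℕ | d % 4 = 1 ∧ Squarefree d}
      (fun d => quadChar d N / (d : ℂ) ^ w) d = 1 / 2 * t1 d + 1 / 2 * t0 d := fun d => by
    by_cases hd : Squarefree d
    · rw [ht1, ht0, term_squarefreePart_kroneckerChar _ _ hd, term_squarefreePart_kroneckerChar _ _ hd,
        Set.indicator_apply, ZMod.χ₄_nat_eq_if_mod_four]
      obtain h | h | h | h : d % 4 = 0 ∨ d % 4 = 1 ∨ d % 4 = 2 ∨ d % 4 = 3 := by omega
      all_goals simp [hd, show d % 2 = d % 4 % 2 by omega, h]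
      all_goals ring
    · rw [ht1, ht0, term_squarefreePart_of_not _ _ hd, term_squarefreePart_of_not _ _ hd]
      simp [hd]
  have e3 : ∀ m : ℕ, Set.indicator {m : ℕ | m % 4 = 3 ∧ Squarefree m}
      (fun m => quadChar (4 * m) N / ((4 * m : ℕ) : ℂ) ^ w) m =
        ε ^ 2 * (4 : ℂ) ^ (-w) / 2 * t1 m - ε ^ 2 * (4 : ℂ) ^ (-w) / 2 * t0 m := fun d => by
    have hq := hmul 2 d
    norm_num at hq
    by_cases hd : Squarefree d
    · rw [ht1, ht0, term_squarefreePart_kroneckerChar _ _ hd, term_squarefreePart_kroneckerChar _ _ hd,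
        Set.indicator_apply, ZMod.χ₄_nat_eq_if_mod_four, hcp, hq, Complex.cpow_neg]
      obtain h | h | h | h : d % 4 = 0 ∨ d % 4 = 1 ∨ d % 4 = 2 ∨ d % 4 = 3 := by omega
      all_goals simp [hd, show d % 2 = d % 4 % 2 by omega, h]
      all_goals ring
    · rw [ht1, ht0, term_squarefreePart_of_not _ _ hd, term_squarefreePart_of_not _ _ hd]
      simp [hd]
  have e8 : ∀ m : ℕ, Set.indicator {m : ℕ | m % 2 = 1 ∧ Squarefree m}
      (fun m => quadChar (8 * m) N / ((8 * m : ℕ) : ℂ) ^ w) m =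
        ε * (8 : ℂ) ^ (-w) * t1 m := fun d => by
    have hq := hmul 3 d
    norm_num [hε3] at hq
    by_cases hd : Squarefree d
    · rw [ht1, term_squarefreePart_kroneckerChar _ _ hd,
        Set.indicator_apply, ZMod.χ₄_nat_eq_if_mod_four, hcp, hq, Complex.cpow_neg]
      obtain h | h | h | h : d % 4 = 0 ∨ d % 4 = 1 ∨ d % 4 = 2 ∨ d % 4 = 3 := by omega
      all_goals simp [hd, show d % 2 = d % 4 % 2 by omega, h]
      all_goals ring
    · rw [ht1, term_squarefreePart_of_not _ _ hd]
      simp [hd]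
  rw [tsum_isPosFundamentalDiscriminant (summable_quadChar_div N hw),
    tsum_subtype {d : ℕ | d % 4 = 1 ∧ Squarefree d} (fun d => quadChar d N / (d : ℂ) ^ w),
    tsum_subtype {m : ℕ | m % 4 = 3 ∧ Squarefree m}
      (fun m => quadChar (4 * m) N / ((4 * m : ℕ) : ℂ) ^ w),
    tsum_subtype {m : ℕ | m % 2 = 1 ∧ Squarefree m}
      (fun m => quadChar (8 * m) N / ((8 * m : ℕ) : ℂ) ^ w),
    tsum_congr e1, tsum_congr e3, tsum_congr e8,
    (hs1.mul_left _).tsum_add (hs0.mul_left _), (hs1.mul_left _).tsum_sub (hs0.mul_left _),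
    tsum_mul_left, tsum_mul_left, tsum_mul_left, tsum_mul_left, tsum_mul_left, LSeries, LSeries,
    ← ht1, ← ht0, evenCoeff, oddCoeff, ← hε]
  ring

end DiscriminantSum

/-! ### Continuation, bounds and value at `w = 1` of the sum over discriminants. -/

section RegularizedSum

open DirichletCharacter

open scoped Classical in
/-- The entire function that extends `(s - 1) L(s, χ)`. -/
noncomputable def entireL {q : ℕ} [NeZero q] (χ : DirichletCharacter ℂ q) (s : ℂ) : ℂ :=
  if χ = 1 then LFunctionTrivChar₁ q s else (s - 1) * LFunction χ s

variable {q : ℕ} [NeZero q]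

lemma entireL_of_ne_one {χ : DirichletCharacter ℂ q} (hχ : χ ≠ 1) (s : ℂ) :
    entireL χ s = (s - 1) * LFunction χ s := if_neg hχ

lemma entireL_one : entireL (1 : DirichletCharacter ℂ q) = LFunctionTrivChar₁ q :=
  funext fun _ => if_pos rfl

lemma entireL_eq (χ : DirichletCharacter ℂ q) {s : ℂ} (hs : s ≠ 1) :
    entireL χ s = (s - 1) * LFunction χ s := by
  by_cases hχ : χ = 1
  · rw [hχ, entireL_one, LFunctionTrivChar₁, Function.update_of_ne hs]
  · exact entireL_of_ne_one hχ s

lemma differentiable_entireL (χ : DirichletCharacter ℂ q) : Differentiable ℂ (entireL χ) := by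
  by_cases hχ : χ = 1
  · rw [hχ, entireL_one]
    exact differentiable_LFunctionTrivChar₁ q
  · rw [show entireL χ = fun s => (s - 1) * LFunction χ s from
      funext fun s => entireL_of_ne_one hχ s]
    exact (differentiable_id.sub_const 1).mul (differentiable_LFunction hχ)

lemma LFunctionTrivChar₁_eq_prod_mul (s : ℂ) :
    LFunctionTrivChar₁ q s =
      (∏ p ∈ q.primeFactors, (1 - 1 * (p : ℂ) ^ (-s))) * LFunctionTrivChar₁ 1 s := by
  by_cases hs : s = 1
  · subst hs
    rw [LFunctionTrivChar₁, LFunctionTrivChar₁, Function.update_self, Function.update_self]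
    simp [Complex.cpow_neg_one]
  · rw [LFunctionTrivChar₁, LFunctionTrivChar₁, Function.update_of_ne hs, Function.update_of_ne hs,
      LFunctionTrivChar_eq_mul_riemannZeta hs, LFunctionTrivChar_eq_mul_riemannZeta hs]
    simp
    ring

/-- The constant is uniform in level and character. For the principal character only the Euler
factors at `p ∣ q` depend on `q`, and `2^{ω(q)} ≪ q^{1/4}`. -/
lemma exists_norm_entireL_le {s₀ : ℂ} (hs₀ : 1 / 2 < s₀.re) :
    ∃ C : ℝ, 0 < C ∧ ∀ᶠ s in 𝓝 s₀, ∀ (q : ℕ) [NeZero q] (χ : DirichletCharacter ℂ q),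
      ‖entireL χ s‖ ≤ C * (q : ℝ) ^ (1 / 4 : ℝ) := by
  obtain ⟨σ, hσ, hσs⟩ := exists_between hs₀
  obtain ⟨C₁, hC₁, h₁⟩ := exists_norm_LFunction_le hσ
  obtain ⟨C₂, hC₂, h₂⟩ := exists_two_pow_card_primeFactors_le (ε := 1 / 4) (by norm_num)
  have hZ : ∀ᶠ s in 𝓝 s₀, ‖LFunctionTrivChar₁ 1 s‖ < ‖LFunctionTrivChar₁ 1 s₀‖ + 1 :=
    ((differentiable_LFunctionTrivChar₁ 1).continuous.norm.tendsto s₀).eventually_lt_const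
      (lt_add_one _)
  have hn : ∀ᶠ s in 𝓝 s₀, ‖s‖ < ‖s₀‖ + 1 :=
    (continuous_norm.tendsto s₀).eventually_lt_const (lt_add_one _)
  have hr : ∀ᶠ s : ℂ in 𝓝 s₀, σ < s.re :=
    (Complex.continuous_re.tendsto s₀).eventually_const_lt hσs
  refine ⟨(‖s₀‖ + 2) * (C₁ * (‖s₀‖ + 1)) + C₂ * (‖LFunctionTrivChar₁ 1 s₀‖ + 1), by positivity, ?_⟩
  filter_upwards [hZ, hn, hr] with s hZs hns hrs q _ χ
  by_cases hχ : χ = 1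
  · rw [hχ, entireL_one, LFunctionTrivChar₁_eq_prod_mul, norm_mul]
    have h3 := norm_prod_one_sub_le q (a := fun _ => 1) (fun _ => by simp) (s := s) (by linarith)
    calc _ ≤ (C₂ * (q : ℝ) ^ (1 / 4 : ℝ)) * (‖LFunctionTrivChar₁ 1 s₀‖ + 1) :=
          mul_le_mul (h3.trans (h₂ q (NeZero.ne q))) hZs.le (norm_nonneg _) (by positivity)
      _ = 0 + C₂ * (‖LFunctionTrivChar₁ 1 s₀‖ + 1) * (q : ℝ) ^ (1 / 4 : ℝ) := by ring
      _ ≤ _ := by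
          rw [add_mul]
          gcongr
          positivity
  · rw [entireL_of_ne_one hχ, norm_mul]
    have h3 : ‖s - 1‖ ≤ ‖s₀‖ + 2 := (norm_sub_le _ _).trans (by rw [norm_one]; linarith)
    have h4 : ‖LFunction χ s‖ ≤ C₁ * (‖s₀‖ + 1) * (q : ℝ) ^ (1 / 4 : ℝ) :=
      (h₁ q χ hχ s hrs.le).trans (by gcongr)
    calc _ ≤ (‖s₀‖ + 2) * (C₁ * (‖s₀‖ + 1) * (q : ℝ) ^ (1 / 4 : ℝ)) :=
          mul_le_mul h3 h4 (norm_nonneg _) (by positivity)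
      _ = (‖s₀‖ + 2) * (C₁ * (‖s₀‖ + 1)) * (q : ℝ) ^ (1 / 4 : ℝ) + 0 := by ring
      _ ≤ _ := by
          have h5 : 0 ≤ C₂ * (‖LFunctionTrivChar₁ 1 s₀‖ + 1) * (q : ℝ) ^ (1 / 4 : ℝ) := by positivity
          rw [add_mul]
          linarith

lemma differentiable_evenCoeff (N : ℕ) : Differentiable ℂ (evenCoeff N) := by
  have h4 : Differentiable ℂ fun w : ℂ => (4 : ℂ) ^ (-w) :=
    differentiable_id.neg.const_cpow (Or.inl (by norm_num))
  have h8 : Differentiable ℂ fun w : ℂ => (8 : ℂ) ^ (-w) :=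
    differentiable_id.neg.const_cpow (Or.inl (by norm_num))
  exact ((h4.const_mul _).const_add _).add (h8.const_mul _)

lemma differentiable_oddCoeff (N : ℕ) : Differentiable ℂ (oddCoeff N) := by
  have h4 : Differentiable ℂ fun w : ℂ => (4 : ℂ) ^ (-w) :=
    differentiable_id.neg.const_cpow (Or.inl (by norm_num))
  exact (h4.const_mul _).const_sub _

lemma norm_kroneckerSymbol_le_one (d : ℤ) (n : ℕ) : ‖(kroneckerSymbol d n : ℂ)‖ ≤ 1 := by
  rw [Complex.norm_intCast]
  exact_mod_cast abs_kroneckerSymbol_le_one d n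

lemma norm_natCast_cpow_neg_le_one {n : ℕ} (hn : 0 < n) {w : ℂ} (hw : 0 ≤ w.re) :
    ‖(n : ℂ) ^ (-w)‖ ≤ 1 := by
  rw [Complex.norm_natCast_cpow_of_pos hn]
  exact Real.rpow_le_one_of_one_le_of_nonpos (by exact_mod_cast hn) (by simpa using hw)

lemma norm_evenCoeff_le {N : ℕ} {w : ℂ} (hw : 0 ≤ w.re) : ‖evenCoeff N w‖ ≤ 2 := by
  have h1 := norm_kroneckerSymbol_le_one 2 N
  have h4 := norm_natCast_cpow_neg_le_one (n := 4) (by norm_num) hw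
  have h8 := norm_natCast_cpow_neg_le_one (n := 8) (by norm_num) hw
  push_cast at h4 h8
  have h2 : ‖(kroneckerSymbol 2 N : ℂ) ^ 2 / 2 * (4 : ℂ) ^ (-w)‖ ≤ 1 / 2 := by
    rw [norm_mul, norm_div, norm_pow, Complex.norm_ofNat]
    have := mul_le_one₀ (pow_le_one₀ (n := 2) (norm_nonneg _) h1) (norm_nonneg _) h4
    linarith
  have h3 : ‖(kroneckerSymbol 2 N : ℂ) * (8 : ℂ) ^ (-w)‖ ≤ 1 := by
    rw [norm_mul]
    exact mul_le_one₀ h1 (norm_nonneg _) h8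
  have h0 : ‖(1 / 2 : ℂ)‖ = 1 / 2 := by norm_num
  refine (norm_add₃_le).trans ?_
  rw [h0]
  linarith

lemma norm_oddCoeff_le {N : ℕ} {w : ℂ} (hw : 0 ≤ w.re) : ‖oddCoeff N w‖ ≤ 2 := by
  have h1 := norm_kroneckerSymbol_le_one 2 N
  have h4 := norm_natCast_cpow_neg_le_one (n := 4) (by norm_num) hw
  push_cast at h4
  have h2 : ‖(kroneckerSymbol 2 N : ℂ) ^ 2 / 2 * (4 : ℂ) ^ (-w)‖ ≤ 1 / 2 := by
    rw [norm_mul, norm_div, norm_pow, Complex.norm_ofNat]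
    have := mul_le_one₀ (pow_le_one₀ (n := 2) (norm_nonneg _) h1) (norm_nonneg _) h4
    linarith
  have h0 : ‖(1 / 2 : ℂ)‖ = 1 / 2 := by norm_num
  refine (norm_sub_le _ _).trans ?_
  rw [h0]
  linarith

/-- The holomorphic extension to `Re w > 1/2` of
`(w - 1) ∑_d χ_d(N) d^{-w}`, the sum over positive fundamental discriminants. -/
noncomputable def discriminantSumExt (N : ℕ) [NeZero N] (w : ℂ) : ℂ :=
  moebiusFactor (8 * N) w * (entireL (kroneckerChar N 1) w * evenCoeff N w +
    entireL (kroneckerChar N 0) w * oddCoeff N w)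

variable (N : ℕ) [NeZero N]

lemma discriminantSumExt_eq {w : ℂ} (hw : 1 < w.re) :
    discriminantSumExt N w = (w - 1) *
      ∑' d : {d : ℕ // IsPosFundamentalDiscriminant d}, quadChar d N / ((d : ℕ) : ℂ) ^ w := by
  have hw1 : w ≠ 1 := fun h => by simp [h] at hw
  rw [tsum_quadChar_div_eq hw, LSeries_squarefreePart_eq (kroneckerChar_sq 1) hw,
    LSeries_squarefreePart_eq (kroneckerChar_sq 0) hw, discriminantSumExt, entireL_eq _ hw1,
    entireL_eq _ hw1, LFunction_eq_LSeries _ hw, LFunction_eq_LSeries _ hw]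
  ring

lemma differentiableAt_discriminantSumExt {w : ℂ} (hw : 1 / 2 < w.re) :
    DifferentiableAt ℂ (discriminantSumExt N) w :=
  (differentiableAt_moebiusFactor _ hw).mul
    (((differentiable_entireL _ w).mul (differentiable_evenCoeff N w)).add
      ((differentiable_entireL _ w).mul (differentiable_oddCoeff N w)))

variable {N}

theorem exists_norm_discriminantSumExt_le {w₀ : ℂ} (hw₀ : 1 / 2 < w₀.re) :
    ∃ C : ℝ, 0 < C ∧ ∀ᶠ w in 𝓝 w₀, ∀ (N : ℕ) [NeZero N],
      ‖discriminantSumExt N w‖ ≤ C * (N : ℝ) ^ (1 / 4 : ℝ) := by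
  obtain ⟨σ, hσ, hσw⟩ := exists_between hw₀
  obtain ⟨C, hC, hE⟩ := exists_norm_entireL_le hw₀
  have hr : ∀ᶠ w : ℂ in 𝓝 w₀, σ < w.re :=
    (Complex.continuous_re.tendsto w₀).eventually_const_lt hσw
  set Z : ℝ := ∑' n : ℕ, (n : ℝ) ^ (-(2 * σ)) with hZ
  have hZ0 : 0 ≤ Z := tsum_nonneg fun n => by positivity
  refine ⟨(Z + 1) * (4 * C * (8 : ℝ) ^ (1 / 4 : ℝ)), by positivity, ?_⟩
  filter_upwards [hE, hr] with w hEw hrw N _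
  have hm : ‖moebiusFactor (8 * N) w‖ ≤ Z + 1 := by
    have := norm_LSeries_le_of_norm_le_one (norm_one_mul_moebius_le (8 * N)) (σ := 2 * σ)
      (by linarith) (s := 2 * w) (by simp; linarith)
    exact this.trans (by linarith)
  have h1 := hEw (8 * N) (kroneckerChar N 1)
  have h0 := hEw (8 * N) (kroneckerChar N 0)
  have c1 := norm_evenCoeff_le (N := N) (w := w) (by linarith)
  have c0 := norm_oddCoeff_le (N := N) (w := w) (by linarith)
  rw [discriminantSumExt, norm_mul]
  rw [Nat.cast_mul, Real.mul_rpow (by positivity) (by positivity), Nat.cast_ofNat] at h1 h0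
  have h2 : ‖entireL (kroneckerChar N 1) w * evenCoeff N w +
      entireL (kroneckerChar N 0) w * oddCoeff N w‖ ≤
        4 * C * (8 : ℝ) ^ (1 / 4 : ℝ) * (N : ℝ) ^ (1 / 4 : ℝ) := by
    refine (norm_add_le _ _).trans ?_
    rw [norm_mul, norm_mul]
    have a1 := mul_le_mul h1 c1 (norm_nonneg _) (by positivity)
    have a0 := mul_le_mul h0 c0 (norm_nonneg _) (by positivity)
    linarith
  rw [mul_assoc]
  gcongr

/-- The trivial bound, without loss in `N`; it serves the part of the convergence region where some
`Re s_j ≤ 5/4`. -/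
theorem exists_norm_discriminantSumExt_le_const {w₀ : ℂ} (hw₀ : 1 < w₀.re) :
    ∃ C : ℝ, 0 < C ∧ ∀ᶠ w in 𝓝 w₀, ∀ (N : ℕ) [NeZero N], ‖discriminantSumExt N w‖ ≤ C := by
  obtain ⟨σ, hσ, hσw⟩ := exists_between hw₀
  have hr : ∀ᶠ w : ℂ in 𝓝 w₀, σ < w.re :=
    (Complex.continuous_re.tendsto w₀).eventually_const_lt hσw
  have hn : ∀ᶠ w in 𝓝 w₀, ‖w‖ < ‖w₀‖ + 1 :=
    (continuous_norm.tendsto w₀).eventually_lt_const (lt_add_one _)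
  have hsum : Summable fun d : {d : ℕ // IsPosFundamentalDiscriminant d} =>
      ((d : ℕ) : ℝ) ^ (-σ) :=
    (Real.summable_nat_rpow.2 (show -σ < -1 by linarith)).comp_injective Subtype.val_injective
  set Z := ∑' d : {d : ℕ // IsPosFundamentalDiscriminant d}, ((d : ℕ) : ℝ) ^ (-σ) with hZ
  have hZ0 : 0 ≤ Z := tsum_nonneg fun n => by positivity
  refine ⟨(‖w₀‖ + 2) * (Z + 1), by positivity, ?_⟩
  filter_upwards [hr, hn] with w hrw hnw N _
  rw [discriminantSumExt_eq N (by linarith), norm_mul]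
  have h3 : ‖w - 1‖ ≤ ‖w₀‖ + 2 := (norm_sub_le _ _).trans (by rw [norm_one]; linarith)
  have h4 : ‖∑' d : {d : ℕ // IsPosFundamentalDiscriminant d},
      quadChar d N / ((d : ℕ) : ℂ) ^ w‖ ≤ Z := by
    refine tsum_of_norm_bounded hsum.hasSum fun d => ?_
    refine (norm_quadChar_div_le d N w fun h => by simp [h] at hrw; linarith).trans ?_
    have hd : (1 : ℝ) ≤ (d : ℕ) := by
      have : (d : ℕ) ≠ 0 := by
        rcases d.2 with h | ⟨m, hm, h, -⟩ <;> omega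
      exact_mod_cast Nat.one_le_iff_ne_zero.2 this
    exact Real.rpow_le_rpow_of_exponent_le hd (by linarith)
  calc _ ≤ (‖w₀‖ + 2) * Z := mul_le_mul h3 h4 (norm_nonneg _) (by positivity)
    _ ≤ _ := by gcongr; linarith

lemma discriminantSumExt_one_of_not_isSquare (hN : ¬ IsSquare N) : discriminantSumExt N 1 = 0 := by
  rw [discriminantSumExt, entireL_of_ne_one (kroneckerChar_one_ne_one hN),
    entireL_of_ne_one kroneckerChar_zero_ne_one]
  simp

lemma kroneckerSymbol_two_of_even (hN : 2 ∣ N) : kroneckerSymbol 2 N = 0 := by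
  rw [kroneckerSymbol_of_ne_zero _ (NeZero.ne N)]
  have h : N.factorization 2 ≠ 0 :=
    (Nat.Prime.factorization_pos_of_dvd Nat.prime_two (NeZero.ne N) hN).ne'
  rw [show ZMod.χ₈ ((2 : ℤ) : ZMod 8) = 0 by decide, zero_pow h, zero_mul]

lemma kroneckerSymbol_two_of_odd_isSquare (hN : ¬ 2 ∣ N) (hsq : IsSquare N) :
    kroneckerSymbol 2 N = 1 := by
  obtain ⟨m, hm⟩ := hsq
  have hm0 : m ≠ 0 := fun h => NeZero.ne N (by rw [hm, h, mul_zero])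
  have hm2 : ¬ 2 ∣ m := fun h => hN (hm ▸ h.mul_right m)
  rw [hm, kroneckerSymbol_mul_right _ hm0 hm0, ← sq]
  refine sq_eq_one_of_abs_le_one (abs_kroneckerSymbol_le_one _ _) ?_
  rw [kroneckerSymbol_of_ne_zero _ hm0, Nat.factorization_eq_zero_of_not_dvd hm2]
  simp only [pow_zero, one_mul, Nat.div_one]
  rw [Ne, jacobiSym.eq_zero_iff, not_and_not_right]
  intro _
  exact (Nat.Prime.coprime_iff_not_dvd Nat.prime_two).2 hm2

/-- For even `N`, `(2 / N) = 0`, the coefficient is `1/2` and the prime 2 is already in `a(N)`. For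
an odd square it is `1/2 + 1/8 + 1/8 = 3/4`, and the extra prime 2 contributes `2/3`. -/
lemma aFactor_eight_mul_mul_evenCoeff (hsq : IsSquare N) :
    aFactor (8 * N) * evenCoeff N 1 = aFactor N / 2 := by
  have hQ : (8 * N).primeFactors = insert 2 N.primeFactors := by
    rw [Nat.primeFactors_mul (by norm_num) (NeZero.ne N), show 8 = 2 ^ 3 by norm_num,
      Nat.primeFactors_prime_pow (by norm_num) Nat.prime_two]
    rfl
  by_cases h2 : 2 ∣ N
  · have hmem : 2 ∈ N.primeFactors := Nat.mem_primeFactors.2 ⟨Nat.prime_two, h2, NeZero.ne N⟩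
    rw [aFactor, hQ, Finset.insert_eq_of_mem hmem, ← aFactor, evenCoeff,
      kroneckerSymbol_two_of_even h2]
    simp
    ring
  · have hmem : 2 ∉ N.primeFactors := fun h => h2 (Nat.dvd_of_mem_primeFactors h)
    rw [aFactor, hQ, Finset.prod_insert hmem, ← aFactor, evenCoeff,
      kroneckerSymbol_two_of_odd_isSquare h2 hsq, Complex.cpow_neg_one, Complex.cpow_neg_one]
    push_cast
    ring

lemma prod_one_sub_inv (n : ℕ) :
    ∏ p ∈ n.primeFactors, (1 - (p : ℂ)⁻¹) =
      (∏ p ∈ n.primeFactors, (1 - (p : ℂ) ^ (-2 : ℂ))) * aFactor n := by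
  rw [aFactor, ← Finset.prod_mul_distrib]
  refine Finset.prod_congr rfl fun p hp => ?_
  have hp0 : (p : ℂ) ≠ 0 := Nat.cast_ne_zero.2 (Nat.prime_of_mem_primeFactors hp).ne_zero
  have hp1 : (p : ℂ) + 1 ≠ 0 := by exact_mod_cast p.succ_ne_zero
  rw [Complex.cpow_neg, Complex.cpow_ofNat]
  field_simp
  ring

/-- The residue of the principal `L`-function is `∏ (1 - 1/p) = a(8N) ∏ (1 - p⁻²)` over `p ∣ 8N`;
the last product cancels against `1 / L(2, χ₀)`, leaving `a(8N) / ζ(2)` times the coefficient. -/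
lemma discriminantSumExt_one_of_isSquare (hsq : IsSquare N) :
    discriminantSumExt N 1 = aFactor N / (2 * riemannZeta 2) := by
  have h2 : (2 : ℂ) ≠ 1 := by norm_num
  have hζ : riemannZeta 2 ≠ 0 := riemannZeta_ne_zero_of_one_lt_re (by norm_num)
  have hm := LSeries_one_mul_moebiusFactor (8 * N) (s := 1) (by norm_num)
  rw [mul_one, ← LFunction_eq_LSeries _ (by norm_num : 1 < (2 : ℂ).re)] at hm
  have hL : LFunction (1 : DirichletCharacter ℂ (8 * N)) 2 = _ :=
    LFunctionTrivChar_eq_mul_riemannZeta h2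
  rw [hL] at hm
  rw [discriminantSumExt, kroneckerChar_one_eq_one hsq, entireL_one,
    entireL_of_ne_one kroneckerChar_zero_ne_one, LFunctionTrivChar₁, Function.update_self,
    prod_one_sub_inv, sub_self, zero_mul, zero_mul, add_zero, mul_assoc _ (aFactor _),
    aFactor_eight_mul_mul_evenCoeff hsq, eq_div_iff (by simpa using hζ)]
  linear_combination aFactor N * hm

end RegularizedSum

/-! ### Summation over tuples: continuation, residue and its nonvanishing. -/

section MultipleDirichletSeries

instance neZero_mul_prod_pnat {k M : ℕ} [NeZero M] (n : Fin k → ℕ+) :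
    NeZero (M * ∏ j, (n j : ℕ)) :=
  ⟨mul_ne_zero (NeZero.ne M) (Finset.prod_ne_zero_iff.2 fun j _ => (n j).ne_zero)⟩

lemma quadChar_mul (d : ℕ) {m n : ℕ} (hm : m ≠ 0) (hn : n ≠ 0) :
    quadChar d (m * n) = quadChar d m * quadChar d n := by
  rw [quadChar, kroneckerSymbol_mul_right _ hm hn, Int.cast_mul]
  rfl

lemma quadChar_prod {ι : Type*} (d : ℕ) (S : Finset ι) (n : ι → ℕ+) :
    quadChar d (∏ j ∈ S, (n j : ℕ)) = ∏ j ∈ S, quadChar d (n j) := by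
  classical
  induction S using Finset.induction_on with
  | empty => simp [quadChar, kroneckerSymbol_one_right]
  | insert a S ha ih =>
    rw [Finset.prod_insert ha, Finset.prod_insert ha, quadChar_mul d (n a).ne_zero
      (Finset.prod_ne_zero_iff.2 fun j _ => (n j).ne_zero), ih]

lemma norm_pnat_cpow (n : ℕ+) (s : ℂ) : ‖((n : ℕ) : ℂ) ^ s‖ = ((n : ℕ) : ℝ) ^ s.re :=
  Complex.norm_natCast_cpow_of_pos n.pos s

lemma norm_div_prod_pnat_cpow_le {k : ℕ} {c : ℂ} {B : ℝ} (hc : ‖c‖ ≤ B) {x : Fin k → ℝ}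
    {s : Fin k → ℂ} (hs : ∀ j, x j ≤ (s j).re) (n : Fin k → ℕ+) :
    ‖c / ∏ j, ((n j : ℕ) : ℂ) ^ s j‖ ≤ B * ∏ j, ((n j : ℕ) : ℝ) ^ (-x j) := by
  rw [norm_div, norm_prod, div_eq_mul_inv, ← Finset.prod_inv_distrib]
  refine mul_le_mul hc (Finset.prod_le_prod (fun _ _ => by positivity) fun j _ => ?_)
    (Finset.prod_nonneg fun _ _ => by positivity) ((norm_nonneg _).trans hc)
  rw [norm_pnat_cpow, ← Real.rpow_neg (Nat.cast_nonneg _)]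
  exact Real.rpow_le_rpow_of_exponent_le (Nat.one_le_cast.2 (n j).pos) (by linarith [hs j])

lemma quadL_eq_tsum_pnat (d : ℕ) (s : ℂ) :
    quadL d s = ∑' n : ℕ+, quadChar d n / ((n : ℕ) : ℂ) ^ s := by
  have h : Function.support (LSeries.term (quadChar d) s) ⊆ Set.range ((↑) : ℕ+ → ℕ) := fun n hn =>
    ⟨⟨n, Nat.pos_of_ne_zero fun h => hn (by simp [h])⟩, rfl⟩
  rw [quadL, LSeries, ← PNat.coe_injective.tsum_eq h]
  exact tsum_congr fun n => LSeries.term_of_ne_zero n.ne_zero _ _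

variable {k : ℕ}

lemma symplecticTerm_eq_tsum (M : ℕ) [NeZero M] {s : Fin k → ℂ} (hs : ∀ j, 1 < (s j).re) (w : ℂ)
    (d : ℕ) :
    symplecticTerm M s w d = ∑' n : Fin k → ℕ+,
      quadChar d (M * ∏ j, (n j : ℕ)) / (d : ℂ) ^ w / ∏ j, ((n j : ℕ) : ℂ) ^ s j := by
  have h := (summable_norm_prod_and_tsum_prod (𝕜 := ℂ)
    (f := fun j (n : ℕ+) => quadChar d n / ((n : ℕ) : ℂ) ^ s j) fun j => ?_).2
  · rw [symplecticTerm]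
    simp_rw [quadL_eq_tsum_pnat]
    rw [← h, mul_div_right_comm, ← tsum_mul_left]
    refine tsum_congr fun n => ?_
    rw [quadChar_mul d (NeZero.ne M) (Finset.prod_ne_zero_iff.2 fun j _ => (n j).ne_zero),
      quadChar_prod, Finset.prod_div_distrib]
    ring
  · refine Summable.of_nonneg_of_le (fun _ => norm_nonneg _) (fun n => ?_)
      (summable_pnat_rpow (hs j))
    rw [norm_div, norm_pnat_cpow, Real.rpow_neg (Nat.cast_nonneg _), ← one_div]
    gcongr
    exact norm_quadChar_le_one _ _

lemma norm_div_natCast_cpow_le {c w : ℂ} (hc : ‖c‖ ≤ 1) {d : ℕ} (hd : 0 < d) :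
    ‖c / (d : ℂ) ^ w‖ ≤ (d : ℝ) ^ (-w.re) := by
  rw [norm_div, Complex.norm_natCast_cpow_of_pos hd, Real.rpow_neg (Nat.cast_nonneg d), ← one_div]
  gcongr

lemma IsPosFundamentalDiscriminant.pos {d : ℕ} (hd : IsPosFundamentalDiscriminant d) : 0 < d := by
  rcases hd with h | ⟨m, hm, h, -⟩ <;> omega

lemma summable_discriminant_rpow {x : ℝ} (hx : 1 < x) :
    Summable fun d : {d : ℕ // IsPosFundamentalDiscriminant d} => ((d : ℕ) : ℝ) ^ (-x) :=
  (Real.summable_nat_rpow.2 (show -x < -1 by linarith)).comp_injective Subtype.val_injective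

lemma summable_uncurry_symplectic (M : ℕ) {s : Fin k → ℂ} (hs : ∀ j, 1 < (s j).re)
    {w : ℂ} (hw : 1 < w.re) :
    Summable fun p : {d : ℕ // IsPosFundamentalDiscriminant d} × (Fin k → ℕ+) =>
      ‖quadChar p.1 (M * ∏ j, (p.2 j : ℕ)) / ((p.1 : ℕ) : ℂ) ^ w /
        ∏ j, ((p.2 j : ℕ) : ℂ) ^ s j‖ := by
  refine Summable.of_nonneg_of_le (fun _ => norm_nonneg _) (fun p => ?_)
    ((summable_discriminant_rpow hw).mul_of_nonneg (summable_prod_pnat_rpow hs)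
      (fun _ => by positivity) fun _ => Finset.prod_nonneg fun _ _ => by positivity)
  exact norm_div_prod_pnat_cpow_le
    (norm_div_natCast_cpow_le (norm_quadChar_le_one _ _) p.1.2.pos) (fun _ => le_rfl) _

theorem summable_norm_symplecticTerm (M : ℕ) [NeZero M] {s : Fin k → ℂ} (hs : ∀ j, 1 < (s j).re)
    {w : ℂ} (hw : 1 < w.re) :
    Summable fun d : {d : ℕ // IsPosFundamentalDiscriminant d} => ‖symplecticTerm M s w d‖ := by
  have h := summable_uncurry_symplectic M hs hw
  refine Summable.of_nonneg_of_le (fun _ => norm_nonneg _) (fun d => ?_) h.prod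
  rw [symplecticTerm_eq_tsum M hs]
  exact norm_tsum_le_tsum_norm (h.prod_factor d)

/-- The contribution of the tuple `n` to `(w - 1) A_M(s; w)`, continued in `w`. -/
noncomputable def regularizedTerm (M : ℕ) [NeZero M] (n : Fin k → ℕ+) (p : (Fin k → ℂ) × ℂ) : ℂ :=
  discriminantSumExt (M * ∏ j, (n j : ℕ)) p.2 / ∏ j, ((n j : ℕ) : ℂ) ^ p.1 j

/-- The continuation of `(w - 1) A_M(s; w)`. -/
noncomputable def regularizedSeries (M : ℕ) [NeZero M] (p : (Fin k → ℂ) × ℂ) : ℂ :=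
  ∑' n : Fin k → ℕ+, regularizedTerm M n p

variable (M : ℕ) [NeZero M]

theorem regularizedSeries_eq {p : (Fin k → ℂ) × ℂ} (hp : p ∈ convergenceRegion k) :
    regularizedSeries M p = (p.2 - 1) * symplecticSeries M p.1 p.2 := by
  obtain ⟨hs, hw⟩ := hp
  have h1 : symplecticSeries M p.1 p.2 =
      ∑' (d : {d : ℕ // IsPosFundamentalDiscriminant d}) (n : Fin k → ℕ+),
        quadChar d (M * ∏ j, (n j : ℕ)) / ((d : ℕ) : ℂ) ^ p.2 / ∏ j, ((n j : ℕ) : ℂ) ^ p.1 j :=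
    tsum_congr fun d => symplecticTerm_eq_tsum M hs p.2 d
  have h2 := (summable_uncurry_symplectic M hs hw).of_norm
  have h3 := Summable.tsum_comm (f := fun (d : {d : ℕ // IsPosFundamentalDiscriminant d})
    (n : Fin k → ℕ+) =>
      quadChar d (M * ∏ j, (n j : ℕ)) / ((d : ℕ) : ℂ) ^ p.2 / ∏ j, ((n j : ℕ) : ℂ) ^ p.1 j) h2
  rw [h1, ← h3, ← tsum_mul_left, regularizedSeries]
  refine tsum_congr fun n => ?_
  rw [tsum_div_const, regularizedTerm, discriminantSumExt_eq _ hw, mul_div_assoc]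

lemma differentiableAt_regularizedTerm (n : Fin k → ℕ+) {p : (Fin k → ℂ) × ℂ}
    (hp : 1 / 2 < p.2.re) : DifferentiableAt ℂ (regularizedTerm M n) p := by
  have h0 : ∀ j, ((n j : ℕ) : ℂ) ≠ 0 := fun j => Nat.cast_ne_zero.2 (n j).ne_zero
  have h1 : DifferentiableAt ℂ (fun p : (Fin k → ℂ) × ℂ =>
      discriminantSumExt (M * ∏ j, (n j : ℕ)) p.2) p :=
    DifferentiableAt.comp (𝕜 := ℂ) (g := discriminantSumExt (M * ∏ j, (n j : ℕ))) p
      (differentiableAt_discriminantSumExt _ hp) differentiableAt_snd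
  have h2 : DifferentiableAt ℂ (fun p : (Fin k → ℂ) × ℂ => ∏ j, ((n j : ℕ) : ℂ) ^ p.1 j) p :=
    (HasFDerivAt.finsetProd fun j _ => (DifferentiableAt.const_cpow
      (by fun_prop : DifferentiableAt ℂ (fun p : (Fin k → ℂ) × ℂ => p.1 j) p)
        (Or.inl (h0 j))).hasFDerivAt).differentiableAt
  have h3 : ∏ j, ((n j : ℕ) : ℂ) ^ p.1 j ≠ 0 :=
    Finset.prod_ne_zero_iff.2 fun j _ => by simp [Complex.cpow_eq_zero_iff, h0 j]
  exact (h1.mul (h2.inv h3)).congr_of_eventuallyEq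
    (Eventually.of_forall fun q => div_eq_mul_inv _ _)

lemma eventually_lt_re {p₀ : (Fin k → ℂ) × ℂ} {x : Fin k → ℝ} (hx : ∀ j, x j < (p₀.1 j).re) :
    ∀ᶠ p in 𝓝 p₀, ∀ j, x j < (p.1 j).re := by
  refine eventually_all.2 fun j => ?_
  have : Continuous fun p : (Fin k → ℂ) × ℂ => (p.1 j).re := by fun_prop
  exact (this.tendsto p₀).eventually_const_lt (hx j)

lemma differentiableAt_regularizedSeries_of_bound {p₀ : (Fin k → ℂ) × ℂ} (hp₀ : 1 / 2 < p₀.2.re)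
    {u : (Fin k → ℕ+) → ℝ} (hu : Summable u)
    (hb : ∀ᶠ p in 𝓝 p₀, ∀ n, ‖regularizedTerm M n p‖ ≤ u n) :
    DifferentiableAt ℂ (regularizedSeries (k := k) M) p₀ := by
  have hr : ∀ᶠ p : (Fin k → ℂ) × ℂ in 𝓝 p₀, 1 / 2 < p.2.re :=
    ((Complex.continuous_re.comp continuous_snd).tendsto p₀).eventually_const_lt hp₀
  exact differentiableAt_tsum_of_summable_norm (hb.and hr) hu
    (fun n p hp => (differentiableAt_regularizedTerm M n hp.2).differentiableWithinAt)
    fun n p hp => hp.1 n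

theorem differentiableAt_regularizedSeries {p₀ : (Fin k → ℂ) × ℂ}
    (hp₀ : p₀ ∈ convergenceRegion k ∪ continuationRegion k) :
    DifferentiableAt ℂ (regularizedSeries M) p₀ := by
  rcases hp₀ with ⟨hs, hw⟩ | ⟨hs, hw⟩
  · choose x hx hxs using fun j => exists_between (hs j)
    obtain ⟨C, hC, hE⟩ := exists_norm_discriminantSumExt_le_const hw
    refine differentiableAt_regularizedSeries_of_bound M (by linarith)
      ((summable_prod_pnat_rpow hx).mul_left C) ?_
    filter_upwards [eventually_lt_re hxs, (continuous_snd.tendsto p₀).eventually hE]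
      with p hps hpE n
    exact norm_div_prod_pnat_cpow_le (hpE _) (fun j => (hps j).le) n
  · choose x hx hxs using fun j => exists_between (hs j)
    obtain ⟨C, hC, hE⟩ := exists_norm_discriminantSumExt_le hw
    -- The factor `N^{1/4} = M^{1/4} ∏ n_j^{1/4}` lowers each exponent by `1/4`; it stays above 1
    -- because `x j > 5/4`.
    refine differentiableAt_regularizedSeries_of_bound M hw
      ((summable_prod_pnat_rpow (x := fun j => x j - 1 / 4)
        (fun j => by linarith [hx j])).mul_left (C * (M : ℝ) ^ (1 / 4 : ℝ))) ?_
    filter_upwards [eventually_lt_re hxs, (continuous_snd.tendsto p₀).eventually hE]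
      with p hps hpE n
    refine (norm_div_prod_pnat_cpow_le (hpE _) (fun j => (hps j).le) n).trans_eq ?_
    rw [Nat.cast_mul, Nat.cast_prod, Real.mul_rpow (by positivity) (by positivity),
      ← Real.finsetProd_rpow _ _ fun _ _ => by positivity, ← mul_assoc, mul_assoc _ (∏ j, _),
      ← Finset.prod_mul_distrib]
    refine congrArg _ (Finset.prod_congr rfl fun j _ => ?_)
    rw [← Real.rpow_add (by exact_mod_cast (n j).pos)]
    congr 1
    ring

lemma norm_aFactor_le_one (n : ℕ) : ‖aFactor n‖ ≤ 1 := by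
  rw [aFactor, norm_prod]
  refine Finset.prod_le_one (fun _ _ => norm_nonneg _) fun p _ => ?_
  have : ‖(p : ℂ) + 1‖ = p + 1 := by exact_mod_cast Complex.norm_natCast (p + 1)
  rw [norm_div, this, Complex.norm_natCast]
  exact div_le_one_of_le₀ (by linarith) (by positivity)

omit [NeZero M] in
theorem summable_norm_diagonalTerm {s : Fin k → ℂ} (hs : ∀ j, 1 < (s j).re) :
    Summable fun n : SquareTuple k M => ‖diagonalTerm M s n.1‖ := by
  have h : Summable fun n : Fin k → ℕ+ => ‖diagonalTerm M s n‖ :=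
    Summable.of_nonneg_of_le (fun _ => norm_nonneg _)
      (fun n => norm_div_prod_pnat_cpow_le (norm_aFactor_le_one _) (fun _ => le_rfl) n)
      ((summable_prod_pnat_rpow hs).mul_left 1)
  exact h.subtype {n | IsSquare (M * ∏ j, (n j : ℕ))}

theorem regularizedSeries_one (s : Fin k → ℂ) :
    regularizedSeries M (s, 1) = diagonalResidue M s := by
  have h := tsum_subtype {n : Fin k → ℕ+ | IsSquare (M * ∏ j, (n j : ℕ))} (diagonalTerm M s)
  rw [diagonalResidue, show ∑' n : SquareTuple k M, diagonalTerm M s n.1 = _ from h,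
    ← tsum_mul_left, regularizedSeries]
  refine tsum_congr fun n => ?_
  rw [regularizedTerm]
  by_cases hn : IsSquare (M * ∏ j, (n j : ℕ))
  · rw [Set.indicator_of_mem (s := {n : Fin k → ℕ+ | IsSquare (M * ∏ j, (n j : ℕ))}) hn,
      diagonalTerm, discriminantSumExt_one_of_isSquare hn]
    ring
  · rw [Set.indicator_of_notMem (s := {n : Fin k → ℕ+ | IsSquare (M * ∏ j, (n j : ℕ))}) hn,
      discriminantSumExt_one_of_not_isSquare hn]
    simp

lemma diagonalResidue_two_ne_zero (hk : 0 < k) : diagonalResidue M (fun _ : Fin k => 2) ≠ 0 := by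
  let r : SquareTuple k M → ℝ := fun n =>
    (∏ p ∈ (M * ∏ j, (n.1 j : ℕ)).primeFactors, (p : ℝ) / (p + 1)) / ∏ j, ((n.1 j : ℕ) : ℝ) ^ 2
  have hr : ∀ n : SquareTuple k M, diagonalTerm M (fun _ : Fin k => 2) n.1 = (r n : ℂ) := fun n => by
    simp only [diagonalTerm, aFactor, r, Complex.cpow_ofNat]
    push_cast
    rfl
  have hpos : ∀ n, 0 < r n := fun n => by
    refine div_pos (Finset.prod_pos fun p hp => ?_) (Finset.prod_pos fun j _ => ?_)
    · have := (Nat.prime_of_mem_primeFactors hp).pos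
      positivity
    · have := (n.1 j).pos
      positivity
  have hsum : Summable r := by
    have := summable_norm_diagonalTerm M (s := fun _ : Fin k => 2) fun _ => by norm_num
    refine this.congr fun n => ?_
    rw [hr, Complex.norm_real, Real.norm_of_nonneg (hpos n).le]
  -- The tuple `(M, 1, …, 1)` has `M ∏ n_j = M²`, so the sum of positive terms is not empty; this
  -- needs `k > 0`.
  let n₀ : SquareTuple k M := ⟨fun j => if j = ⟨0, hk⟩ then ⟨M, NeZero.pos M⟩ else 1, M, by
    congr 1
    rw [Finset.prod_eq_single ⟨0, hk⟩ (fun j _ hj => by simp [hj]) (by simp)]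
    exact congrArg PNat.val (if_pos rfl)⟩
  have hζ : riemannZeta 2 ≠ 0 := riemannZeta_ne_zero_of_one_lt_re (by norm_num)
  rw [diagonalResidue, tsum_congr hr, ← Complex.ofReal_tsum]
  refine mul_ne_zero (by simpa using hζ) ?_
  exact_mod_cast (hsum.tsum_pos (fun n => (hpos n).le) n₀ (hpos n₀)).ne'

/-- Vanishing near `s₀` would propagate along the complex line from `s₀` to `(2, …, 2)`, whose part
in the domain is convex, and contradict positivity there. -/
theorem subset_closure_diagonalResidue_ne_zero (hk : 0 < k) :
    {s : Fin k → ℂ | ∀ j, 5 / 4 < (s j).re} ⊆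
      closure {s : Fin k → ℂ | (∀ j, 5 / 4 < (s j).re) ∧ diagonalResidue M s ≠ 0} := by
  intro s₀ hs₀
  by_contra hcl
  rw [mem_closure_iff_frequently, not_frequently] at hcl
  let ℓ : ℂ → Fin k → ℂ := fun z j => s₀ j + z * (2 - s₀ j)
  have hℓ : Continuous ℓ := by fun_prop
  let U : Set ℂ := {z | ∀ j, 5 / 4 < (ℓ z j).re}
  have hUo : IsOpen U := by
    have : U = ⋂ j, {z | 5 / 4 < (ℓ z j).re} := by
      ext z
      simp [U]
    rw [this]
    exact isOpen_iInter_of_finite fun j => isOpen_lt continuous_const (by fun_prop)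
  have hUc : Convex ℝ U := by
    intro z hz z' hz' a b ha hb hab j
    have h1 := hz j
    have h2 := hz' j
    have h3 : ℓ (a • z + b • z') j = a * ℓ z j + b * ℓ z' j := by
      have : (b : ℂ) = 1 - a := by rw [eq_sub_iff_add_eq']; exact_mod_cast hab
      simp only [ℓ, Complex.real_smul, this]
      ring
    rw [h3, Complex.add_re, Complex.re_ofReal_mul, Complex.re_ofReal_mul]
    obtain rfl : b = 1 - a := by linarith
    rcases eq_or_lt_of_le ha with rfl | ha'
    · simpa using h2
    · nlinarith
  have h0 : (0 : ℂ) ∈ U := fun j => by simpa [ℓ] using hs₀ j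
  have h1 : (1 : ℂ) ∈ U := fun j => by simp [ℓ]; norm_num
  let g : ℂ → ℂ := fun z => regularizedSeries M (ℓ z, 1)
  have hg : DifferentiableOn ℂ g U := fun z hz => by
    have hd := differentiableAt_regularizedSeries M (p₀ := (ℓ z, 1))
      (Or.inr ⟨hz, by norm_num⟩)
    refine (DifferentiableAt.comp (𝕜 := ℂ) (g := regularizedSeries M)
      (f := fun z => (ℓ z, (1 : ℂ))) z hd ?_).differentiableWithinAt
    refine DifferentiableAt.prodMk (differentiableAt_pi.2 fun j => ?_) (differentiableAt_const _)
    fun_prop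
  have hg0 : g =ᶠ[𝓝 0] 0 := by
    have ht : Tendsto ℓ (𝓝 0) (𝓝 s₀) := by
      have := hℓ.tendsto 0
      rwa [show ℓ 0 = s₀ from funext fun j => by simp [ℓ]] at this
    filter_upwards [ht.eventually hcl, hUo.mem_nhds h0] with z hz hzU
    by_contra hne
    refine hz ⟨hzU, ?_⟩
    rwa [← regularizedSeries_one]
  have := AnalyticOnNhd.eqOn_zero_of_preconnected_of_eventuallyEq_zero
    (hg.analyticOnNhd hUo) hUc.isPreconnected h0 hg0 h1
  refine diagonalResidue_two_ne_zero M hk ?_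
  rw [← regularizedSeries_one, ← show ℓ 1 = fun _ => 2 from funext fun j => by simp [ℓ]]
  exact this

end MultipleDirichletSeries

/-! ### The main theorem. -/

theorem mainTheorem6 (k M : ℕ) (hk : 0 < k) (hM : 0 < M) :
    -- absolute convergence of the multiple Dirichlet series
    (∀ p ∈ convergenceRegion k,
      Summable fun d : {d : ℕ // IsPosFundamentalDiscriminant d} =>
        ‖symplecticTerm M p.1 p.2 d‖) ∧
    -- absolute convergence of the series that defines `T_M(S)`
    (∀ s : Fin k → ℂ, (∀ j, 5 / 4 < (s j).re) →
      Summable fun n : SquareTuple k M => ‖diagonalTerm M s n.1‖) ∧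
    -- the meromorphic continuation `A`, in all variables jointly
    (∃ A : (Fin k → ℂ) × ℂ → ℂ,
      (∀ p ∈ convergenceRegion k, A p = symplecticSeries M p.1 p.2) ∧
      -- `A` is holomorphic off the hyperplane `w = 1`
      DifferentiableOn ℂ A
        ((convergenceRegion k ∪ continuationRegion k) \ {p | p.2 = 1}) ∧
      -- `(w - 1) A` extends holomorphically across it, with the value `T_M(S)` at `w = 1`
      (∃ F : (Fin k → ℂ) × ℂ → ℂ,
        DifferentiableOn ℂ F (convergenceRegion k ∪ continuationRegion k) ∧
        (∀ p ∈ convergenceRegion k ∪ continuationRegion k, p.2 ≠ 1 →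
          F p = (p.2 - 1) * A p) ∧
        ∀ s : Fin k → ℂ, (∀ j, 5 / 4 < (s j).re) → F (s, 1) = diagonalResidue M s) ∧
      -- for fixed `s`: the residue at `w = 1` is `T_M(S)`, and the pole is simple
      -- wherever `T_M(S)` is nonzero
      ∀ s : Fin k → ℂ, (∀ j, 5 / 4 < (s j).re) →
        Tendsto (fun w : ℂ => (w - 1) * A (s, w)) (𝓝[≠] 1) (𝓝 (diagonalResidue M s)) ∧
        (diagonalResidue M s ≠ 0 → meromorphicOrderAt (fun w : ℂ => A (s, w)) 1 = -1)) ∧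
    -- there is a genuine pole along `w = 1`: `T_M(S)` is nonzero on a dense set
    {s : Fin k → ℂ | ∀ j, 5 / 4 < (s j).re} ⊆
      closure {s : Fin k → ℂ | (∀ j, 5 / 4 < (s j).re) ∧ diagonalResidue M s ≠ 0} := by
  have : NeZero M := ⟨hM.ne'⟩
  have hlim : ∀ s : Fin k → ℂ, (∀ j, 5 / 4 < (s j).re) →
      AnalyticAt ℂ (fun w : ℂ => regularizedSeries M (s, w)) 1 := fun s hs => by
    rw [Complex.analyticAt_iff_eventually_differentiableAt]
    have h : ∀ᶠ w : ℂ in 𝓝 1, 1 / 2 < w.re :=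
      (Complex.continuous_re.tendsto 1).eventually_const_lt (by norm_num)
    filter_upwards [h] with w hw
    exact DifferentiableAt.comp (𝕜 := ℂ) (g := regularizedSeries M) (f := fun w : ℂ => (s, w)) w
      (differentiableAt_regularizedSeries M (Or.inr ⟨hs, hw⟩))
      ((differentiableAt_const s).prodMk differentiableAt_id)
  refine ⟨fun p hp => summable_norm_symplecticTerm M hp.1 hp.2,
    fun s hs => summable_norm_diagonalTerm M fun j => by linarith [hs j],
    -- On `w = 1` the quotient takes the default value 0; neither holomorphy off the hyperplane, nor
    -- the punctured limit, nor the meromorphic order sees it.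
    ⟨fun p => regularizedSeries M p / (p.2 - 1), fun p hp => ?_, fun p hp => ?_,
      ⟨regularizedSeries M,
        fun p hp => (differentiableAt_regularizedSeries M hp).differentiableWithinAt,
        fun p _ hp1 => ?_, fun s _ => regularizedSeries_one M s⟩, fun s hs => ⟨?_, fun hne => ?_⟩⟩,
    subset_closure_diagonalResidue_ne_zero M hk⟩
  · have hp1 : p.2 - 1 ≠ 0 := sub_ne_zero.2 fun h => by
      have := hp.2
      rw [h] at this
      simp at this
    simp only
    rw [regularizedSeries_eq M hp, mul_div_cancel_left₀ _ hp1]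
  · exact (((differentiableAt_regularizedSeries M hp.1).mul
      ((differentiableAt_snd.sub_const 1).inv (sub_ne_zero.2 hp.2))).congr_of_eventuallyEq
        (Eventually.of_forall fun q => div_eq_mul_inv _ _)).differentiableWithinAt
  · rw [mul_div_cancel₀ _ (sub_ne_zero.2 hp1)]
  · rw [← regularizedSeries_one]
    refine ((hlim s hs).continuousAt.tendsto.mono_left nhdsWithin_le_nhds).congr' ?_
    filter_upwards [self_mem_nhdsWithin] with w hw
    exact (mul_div_cancel₀ _ (sub_ne_zero.2 hw)).symm
  · have hd : AnalyticAt ℂ (fun w : ℂ => w - 1) 1 := by fun_prop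
    have hmer : MeromorphicAt (fun w : ℂ => regularizedSeries M (s, w) / (w - 1)) 1 :=
      (hlim s hs).meromorphicAt.div hd.meromorphicAt
    refine (meromorphicOrderAt_eq_int_iff (n := -1) hmer).2
      ⟨_, hlim s hs, by rwa [regularizedSeries_one], Eventually.of_forall fun w => ?_⟩
    rw [zpow_neg_one, smul_eq_mul, div_eq_inv_mul]
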